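/- Let $n\ge 1$ be an integer. For $\alpha>0$ let $$\Phi_\alpha(x,t)=\frac{t^{\alpha-1}}{\Gamma(\alpha)}\,\frac{1}{(4\pi t)^{n/2}}\,e^{-|x|^2/(4t)}\quad(x\in\mathbb{R}^n,\ t>0),\qquad \Phi_\alpha(x,t)=0\quad(t\le 0),$$ and for a nonnegative measurable $f:\mathbb{R}^n\times\mathbb{R}\to\mathbb{R}$ let $$J_\alpha f(x,t)=\iint_{\mathbb{R}^n\times(-\infty,t)}\Phi_\alpha(x-\xi,t-\tau)f(\xi,\tau)\,d\xi\,d\tau\in[0,\infty].$$ For $1\le p<\infty$ let $X^p$ be the set of measurable $f:\mathbb{R}^n\times\mathbb{R}\to\mathbb{R}$ with $\|f\|_{L^p(\mathbb{R}^n\times(-\infty,T))}<\infty$ for all $T\in\mathbb{R}$, and let $$E=\Big\{(\lambda,\alpha):\lambda>1,\ 0<\alpha<\tfrac{n+2}{2p}\big(1-\tfrac1\lambda\big)\Big\}.$$ **Theorem 3.2.** Let $\lambda,\alpha>0$, and suppose that either $p=1$, or $p\in(1,\infty)$ and $(\lambda,\alpha)$ does not lie on the curve $\alpha=\frac{n+2}{2p}\big(1-\frac1\lambda\big)$,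 $1<\lambda<\infty$. Then there exist constants $C_1,C_2>0$ for which the approximate $J_\alpha$ problem $$C_1 f\le (J_\alpha f)^\lambda\le C_2 f\ \text{ in }\mathbb{R}^n\times\mathbb{R},\qquad f=0\ \text{ in }\mathbb{R}^n\times(-\infty,0)$$ (the relations being understood almost everywhere) has a nonnegative solution $f\in X^p$ that is not almost everywhere zero if and only if $(\lambda,\alpha)\in E$. In that case, such a solution, for some $C_1,C_2>0$ and with the relations holding at every point, is given by $f=u^\lambda$, where $$u(x,t)=\begin{cases}t^{-\frac{\alpha}{\lambda-1}}\,w_\alpha(x/\sqrt t)& t>0,\\ 0& t\le 0,\end{cases}\qquad w_\alpha(z)=e^{-|z|^2/4}\,(|z|^2+1)^{-\left(\frac{n+2}{2}-\frac{\alpha\lambda}{\lambda-1}\right)}.$$ -/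

import Mathlib

open MeasureTheory

noncomputable section

/-- Space-time `ℝⁿ × ℝ`, with the Euclidean norm on `ℝⁿ` and the product Lebesgue measure. -/
abbrev SpaceTime (n : ℕ) : Type := EuclideanSpace ℝ (Fin n) × ℝ

/-- The fractional heat kernel
`Φ_α(x,t) = t^(α-1)/Γ(α) · (4πt)^(-n/2) · exp(-|x|²/(4t))` for `t > 0`, and `0` for `t ≤ 0`. -/
def fracHeatKernel (n : ℕ) (α : ℝ) (z : SpaceTime n) : ℝ :=
  if 0 < z.2 then
    z.2 ^ (α - 1) / Real.Gamma α * (1 / (4 * Real.pi * z.2) ^ ((n : ℝ) / 2))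
      * Real.exp (-‖z.1‖ ^ 2 / (4 * z.2))
  else 0

/-- `J_α f(x,t) = ∬_{ℝⁿ × (-∞,t)} Φ_α(x-ξ,t-τ) f(ξ,τ) dξ dτ` for nonnegative `f`,
as an extended nonnegative real. -/
def fracHeatPotential (n : ℕ) (α : ℝ) (f : SpaceTime n → ℝ) (z : SpaceTime n) : ENNReal :=
  ∫⁻ y in (Set.univ : Set (EuclideanSpace ℝ (Fin n))) ×ˢ Set.Iio z.2,
    ENNReal.ofReal (fracHeatKernel n α (z - y) * f y)

/-- Membership in `X^p = ⋂_T L^p(ℝⁿ × (-∞,T))`. -/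
def MemXp (n : ℕ) (p : ℝ) (f : SpaceTime n → ℝ) : Prop :=
  ∀ T : ℝ, MemLp f (ENNReal.ofReal p)
    (volume.restrict ((Set.univ : Set (EuclideanSpace ℝ (Fin n))) ×ˢ Set.Iio T))

/-- `f ∈ X^p` is a nonnegative solution of the approximate `J_α` problem
`C₁ f ≤ (J_α f)^lam ≤ C₂ f` in `ℝⁿ × ℝ`, `f = 0` in `ℝⁿ × (-∞,0)`,
all relations holding almost everywhere. -/
structure IsApproxSolution (n : ℕ) (p lam α C₁ C₂ : ℝ) (f : SpaceTime n → ℝ) : Prop where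
  memXp : MemXp n p f
  nonneg : ∀ᵐ z : SpaceTime n, 0 ≤ f z
  lower : ∀ᵐ z : SpaceTime n, ENNReal.ofReal (C₁ * f z) ≤ fracHeatPotential n α f z ^ lam
  upper : ∀ᵐ z : SpaceTime n, fracHeatPotential n α f z ^ lam ≤ ENNReal.ofReal (C₂ * f z)
  initial : ∀ᵐ z : SpaceTime n, z.2 < 0 → f z = 0

/-- The same problem, all relations holding at every point. -/
structure IsPointwiseApproxSolution (n : ℕ) (p lam α C₁ C₂ : ℝ) (f : SpaceTime n → ℝ) :
    Prop where
  memXp : MemXp n p f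
  nonneg : ∀ z : SpaceTime n, 0 ≤ f z
  lower : ∀ z : SpaceTime n, ENNReal.ofReal (C₁ * f z) ≤ fracHeatPotential n α f z ^ lam
  upper : ∀ z : SpaceTime n, fracHeatPotential n α f z ^ lam ≤ ENNReal.ofReal (C₂ * f z)
  initial : ∀ z : SpaceTime n, z.2 < 0 → f z = 0

theorem IsPointwiseApproxSolution.isApproxSolution {n : ℕ} {p lam α C₁ C₂ : ℝ}
    {f : SpaceTime n → ℝ} (h : IsPointwiseApproxSolution n p lam α C₁ C₂ f) :
    IsApproxSolution n p lam α C₁ C₂ f :=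
  ⟨h.memXp, Filter.Eventually.of_forall h.nonneg, Filter.Eventually.of_forall h.lower,
    Filter.Eventually.of_forall h.upper, Filter.Eventually.of_forall h.initial⟩

/-- `f` is nontrivial: it is not almost everywhere zero. -/
def IsNontrivial (n : ℕ) (f : SpaceTime n → ℝ) : Prop :=
  ¬ ∀ᵐ z : SpaceTime n, f z = 0

/-- The region `E` of points `(lam, α)` with `lam > 1` and
`0 < α < (n+2)/(2p) · (1 - 1/lam)`. -/
def regionE (n : ℕ) (p : ℝ) : Set (ℝ × ℝ) :=
  {q | 1 < q.1 ∧ 0 < q.2 ∧ q.2 < ((n : ℝ) + 2) / (2 * p) * (1 - 1 / q.1)}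

/-- The curve `α = (n+2)/(2p) · (1 - 1/lam)`, `1 < lam < ∞`. -/
def critCurve (n : ℕ) (p : ℝ) : Set (ℝ × ℝ) :=
  {q | 1 < q.1 ∧ q.2 = ((n : ℝ) + 2) / (2 * p) * (1 - 1 / q.1)}

/-- `w_α(z) = exp(-|z|²/4) (|z|²+1)^(-((n+2)/2 - α lam/(lam-1)))`. -/
def selfSimilarProfile (n : ℕ) (lam α : ℝ) (z : EuclideanSpace ℝ (Fin n)) : ℝ :=
  Real.exp (-‖z‖ ^ 2 / 4) *
    (‖z‖ ^ 2 + 1) ^ (-(((n : ℝ) + 2) / 2 - α * lam / (lam - 1)))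

/-- `u(x,t) = t^(-α/(lam-1)) w_α(x/√t)` for `t > 0`, and `0` for `t ≤ 0`. -/
def selfSimilar (n : ℕ) (lam α : ℝ) (z : SpaceTime n) : ℝ :=
  if 0 < z.2 then
    z.2 ^ (-(α / (lam - 1))) * selfSimilarProfile n lam α ((Real.sqrt z.2)⁻¹ • z.1)
  else 0

end

/-! A solution is comparable to the power `lam` of its own potential, so nonexistence rests on two
one-sided inequalities, `F ≤ C (J F)^lam` and `c (J F)^lam ≤ F`, for one Borel function `F` with
values in `[0, ∞]`. Under `(x, t) ↦ (√s x, s t)` the kernel scales by `s^(α-1-n/2)` and volume by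
`s^(n/2+1)`; the curve is where the powers of the scale balance.

Above the curve, `lam = 1` included, the first inequality suffices. The kernel cut to time lags
below `δ` lies in `L^r`, with `r` the Young exponent from `L^p` to `L^(p lam)`, and its norm tends
to `0` with `δ`. Hence the `L^p` mass of `F` just after a time before which `F` vanishes is at most
a fraction of itself, so it is zero, and one marches forward from time `0`
(`ae_eq_zero_of_le_heatPot_rpow`).

The second inequality gives the other two cases. For `lam < 1`, lower bounds `K (t-a)^β` of the
potential improve by `K ↦ κ' K^lam`, whose attracting fixed point does not depend on the place. So
`F` is bounded below on a whole strip, of infinite measure, and is not in `L^p`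
(`exists_strip_lower_bound`). On the curve with `p = 1`, Fujita's critical argument applies: too
much mass in a parabolic cylinder forces the potential to be infinite on an open set
(`exists_blowup_threshold`), yet each doubling of the radius adds at least a fixed amount of mass
(`ae_eq_zero_of_heatPot_rpow_le_of_critical`).

In the region `E`, homogeneity reduces the two-sided estimate for the explicit function to time `1`.
The source at time `τ` is a Gaussian narrower than the heat kernel, so its contribution at `z` is at
most about `exp(-|z|²/4) exp(-κ τ |z|²)` times powers of `τ` and `1-τ`. Times `τ` of order
`1/(|z|²+1)` dominate and produce the algebraic factor of the profile
(`exists_heatPot_selfSimilar_le`, `exists_le_heatPot_selfSimilar`). -/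

instance SpaceTime.isAddHaarMeasure_volume (n : ℕ) :
    (volume : Measure (SpaceTime n)).IsAddHaarMeasure :=
  inferInstanceAs ((volume : Measure (EuclideanSpace ℝ (Fin n))).prod
    (volume : Measure ℝ)).IsAddHaarMeasure

/-! ### The kernel and its potential -/

/-- The normalizing constant of the fractional heat kernel. -/
noncomputable def fracHeatConst (n : ℕ) (α : ℝ) : ℝ :=
  1 / Real.Gamma α * (1 / (4 * Real.pi) ^ ((n : ℝ) / 2))

theorem fracHeatConst_pos (n : ℕ) {α : ℝ} (hα : 0 < α) : 0 < fracHeatConst n α := by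
  have := Real.Gamma_pos_of_pos hα
  unfold fracHeatConst
  positivity

theorem fracHeatKernel_of_pos (n : ℕ) (α : ℝ) (z : SpaceTime n) (hz : 0 < z.2) :
    fracHeatKernel n α z =
      fracHeatConst n α * z.2 ^ (α - 1 - (n : ℝ) / 2) * Real.exp (-‖z.1‖ ^ 2 / (4 * z.2)) := by
  have h1 : (4 * Real.pi * z.2) ^ ((n : ℝ) / 2)
      = (4 * Real.pi) ^ ((n : ℝ) / 2) * z.2 ^ ((n : ℝ) / 2) :=
    Real.mul_rpow (by positivity) hz.le
  rw [fracHeatKernel, if_pos hz, h1, fracHeatConst, Real.rpow_sub hz (α - 1)]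
  ring

theorem fracHeatKernel_of_nonpos (n : ℕ) (α : ℝ) (z : SpaceTime n) (hz : z.2 ≤ 0) :
    fracHeatKernel n α z = 0 := by
  rw [fracHeatKernel, if_neg hz.not_gt]

theorem fracHeatKernel_nonneg (n : ℕ) {α : ℝ} (hα : 0 < α) (z : SpaceTime n) :
    0 ≤ fracHeatKernel n α z := by
  rcases lt_or_ge 0 z.2 with hz | hz
  · rw [fracHeatKernel_of_pos n α z hz]
    have := fracHeatConst_pos n hα
    positivity
  · rw [fracHeatKernel_of_nonpos n α z hz]

theorem measurable_fracHeatKernel (n : ℕ) (α : ℝ) : Measurable (fracHeatKernel n α) := by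
  unfold fracHeatKernel
  refine Measurable.ite (measurableSet_lt measurable_const measurable_snd) ?_ measurable_const
  fun_prop

/-- The convolution of a nonnegative function on space-time with the fractional heat kernel. -/
noncomputable def heatPot (n : ℕ) (α : ℝ) (F : SpaceTime n → ENNReal) (z : SpaceTime n) :
    ENNReal :=
  ∫⁻ y, ENNReal.ofReal (fracHeatKernel n α (z - y)) * F y

theorem fracHeatPotential_eq_heatPot (n : ℕ) {α : ℝ} (hα : 0 < α) (f : SpaceTime n → ℝ)
    (z : SpaceTime n) :
    fracHeatPotential n α f z = heatPot n α (fun y => ENNReal.ofReal (f y)) z := by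
  have hs : MeasurableSet ((Set.univ : Set (EuclideanSpace ℝ (Fin n))) ×ˢ Set.Iio z.2) :=
    MeasurableSet.univ.prod measurableSet_Iio
  rw [fracHeatPotential, heatPot, ← lintegral_indicator hs]
  refine lintegral_congr fun y => ?_
  by_cases hy : y.2 < z.2
  · rw [Set.indicator_of_mem (by simpa using hy),
      ENNReal.ofReal_mul (fracHeatKernel_nonneg n hα _)]
  · rw [Set.indicator_of_notMem (by simpa using hy),
      fracHeatKernel_of_nonpos n α (z - y) (by simpa using hy)]
    simp

theorem heatPot_congr_ae (n : ℕ) (α : ℝ) {F G : SpaceTime n → ENNReal} (h : F =ᵐ[volume] G)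
    (z : SpaceTime n) : heatPot n α F z = heatPot n α G z :=
  lintegral_congr_ae (h.mono fun y hy => by simp only [hy])

/-- On a parabolic annulus of scale `ρ` the kernel is bounded below by a multiple of its
self-similar size. -/
theorem exists_le_fracHeatKernel (n : ℕ) {α : ℝ} (hα : 0 < α) {B : ℝ} (hB : 1 ≤ B) :
    ∃ κ : ℝ, 0 < κ ∧ ∀ ρ : ℝ, 0 < ρ → ∀ z : SpaceTime n, ρ / B ≤ z.2 → z.2 ≤ B * ρ →
      ‖z.1‖ ^ 2 ≤ B * ρ → κ * ρ ^ (α - 1 - (n : ℝ) / 2) ≤ fracHeatKernel n α z := by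
  have hB0 : 0 < B := by linarith
  have hc := fracHeatConst_pos n hα
  set e := α - 1 - (n : ℝ) / 2 with he
  -- The ratio `z.2 / ρ` lies in `[1/B, B]`, so `B ^ (-|e|)` bounds its power `e` from below
  -- whatever the sign of `e`.
  refine ⟨fracHeatConst n α * B ^ (-|e|) * Real.exp (-(B ^ 2 / 4)), by positivity, ?_⟩
  intro ρ hρ z h1 h2 h3
  have hz : 0 < z.2 := lt_of_lt_of_le (by positivity) h1
  rw [fracHeatKernel_of_pos n α z hz]
  have hs : B ^ (-|e|) * ρ ^ e ≤ z.2 ^ e := by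
    have hq : z.2 = (z.2 / ρ) * ρ := by field_simp
    have hq1 : B⁻¹ ≤ z.2 / ρ := by
      rw [le_div_iff₀ hρ]; rw [div_eq_inv_mul] at h1; exact h1
    have hq2 : z.2 / ρ ≤ B := by rw [div_le_iff₀ hρ]; exact h2
    have hq0 : 0 < z.2 / ρ := by positivity
    rw [hq, Real.mul_rpow hq0.le hρ.le]
    refine mul_le_mul_of_nonneg_right ?_ (by positivity)
    rcases le_total 0 e with h | h
    · rw [abs_of_nonneg h, Real.rpow_neg hB0.le, ← Real.inv_rpow hB0.le]
      exact Real.rpow_le_rpow (by positivity) hq1 h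
    · rw [abs_of_nonpos h, neg_neg]
      exact Real.rpow_le_rpow_of_nonpos hq0 hq2 h
  have hx : Real.exp (-(B ^ 2 / 4)) ≤ Real.exp (-‖z.1‖ ^ 2 / (4 * z.2)) := by
    apply Real.exp_le_exp.2
    rw [neg_div, neg_le_neg_iff, div_le_div_iff₀ (by positivity) (by norm_num)]
    rw [div_le_iff₀ hB0] at h1
    nlinarith
  calc fracHeatConst n α * B ^ (-|e|) * Real.exp (-(B ^ 2 / 4)) * ρ ^ e
      = fracHeatConst n α * ((B ^ (-|e|) * ρ ^ e) * Real.exp (-(B ^ 2 / 4))) := by ring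
    _ ≤ fracHeatConst n α * (z.2 ^ e * Real.exp (-‖z.1‖ ^ 2 / (4 * z.2))) := by gcongr
    _ = _ := by ring

/-! ### Gaussian integrals -/

theorem lintegral_gaussian (n : ℕ) {b : ℝ} (hb : 0 < b) (v : EuclideanSpace ℝ (Fin n)) :
    ∫⁻ ξ : EuclideanSpace ℝ (Fin n), ENNReal.ofReal (Real.exp (-b * ‖ξ - v‖ ^ 2))
      = ENNReal.ofReal ((Real.pi / b) ^ ((n : ℝ) / 2)) := by
  rw [lintegral_sub_right_eq_self
    (fun ξ : EuclideanSpace ℝ (Fin n) => ENNReal.ofReal (Real.exp (-b * ‖ξ‖ ^ 2))) v]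
  have h := GaussianFourier.integral_rexp_neg_mul_sq_norm
    (V := EuclideanSpace ℝ (Fin n)) hb
  rw [finrank_euclideanSpace_fin] at h
  have hpos : 0 < (Real.pi / b) ^ ((n : ℝ) / 2) := by positivity
  have hint : Integrable (fun ξ : EuclideanSpace ℝ (Fin n) => Real.exp (-b * ‖ξ‖ ^ 2)) := by
    by_contra hc
    rw [integral_undef hc] at h
    linarith
  rw [← ofReal_integral_eq_lintegral_ofReal hint
    (Filter.Eventually.of_forall fun _ => (Real.exp_pos _).le), h]

theorem lintegral_rpow_Ioo {e T : ℝ} (he : -1 < e) (hT : 0 ≤ T) :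
    ∫⁻ t in Set.Ioo 0 T, ENNReal.ofReal (t ^ e) = ENNReal.ofReal (T ^ (e + 1) / (e + 1)) := by
  have hi : IntegrableOn (fun t : ℝ => t ^ e) (Set.Ioo 0 T) :=
    ((intervalIntegral.intervalIntegrable_rpow' (a := 0) (b := T) he).1).mono_set
      Set.Ioo_subset_Ioc_self
  rw [← ofReal_integral_eq_lintegral_ofReal hi
    ((ae_restrict_iff' measurableSet_Ioo).2
      (Filter.Eventually.of_forall fun t ht => Real.rpow_nonneg ht.1.le e)),
    ← integral_Ioc_eq_integral_Ioo, ← intervalIntegral.integral_of_le hT,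
    integral_rpow (Or.inl he), Real.zero_rpow (by linarith), sub_zero]

/-- The integral of a Gaussian of width `√t` times a power of `t` over a strip. -/
theorem lintegral_strip_gaussian (n : ℕ) {e b T : ℝ} (he : -1 < e + (n : ℝ) / 2) (hb : 0 < b)
    (hT : 0 ≤ T) :
    ∫⁻ z : SpaceTime n in Set.univ ×ˢ Set.Ioo 0 T,
      ENNReal.ofReal (z.2 ^ e * Real.exp (-b * ‖z.1‖ ^ 2 / z.2))
      = ENNReal.ofReal ((Real.pi / b) ^ ((n : ℝ) / 2)
          * (T ^ (e + (n : ℝ) / 2 + 1) / (e + (n : ℝ) / 2 + 1))) := by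
  rw [Measure.volume_eq_prod, ← Measure.prod_restrict, Measure.restrict_univ,
    lintegral_prod_symm' _ (by fun_prop), ENNReal.ofReal_mul (by positivity),
    ← lintegral_rpow_Ioo he hT, ← lintegral_const_mul _ (by fun_prop)]
  refine setLIntegral_congr_fun measurableSet_Ioo fun t ht => ?_
  have ht0 : 0 < t := ht.1
  have h := lintegral_gaussian n (b := b / t) (by positivity) 0
  simp only [sub_zero] at h
  have h2 : ∀ x : EuclideanSpace ℝ (Fin n),
      ENNReal.ofReal (t ^ e * Real.exp (-b * ‖x‖ ^ 2 / t))
        = ENNReal.ofReal (t ^ e) * ENNReal.ofReal (Real.exp (-(b / t) * ‖x‖ ^ 2)) := by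
    intro x
    rw [← ENNReal.ofReal_mul (by positivity)]
    congr 3
    ring
  simp only [h2]
  rw [lintegral_const_mul _ (by fun_prop), h, ← ENNReal.ofReal_mul (by positivity),
    ← ENNReal.ofReal_mul (by positivity)]
  congr 1
  rw [show Real.pi / (b / t) = Real.pi / b * t by field_simp,
    Real.mul_rpow (by positivity) ht0.le, Real.rpow_add ht0]
  ring

theorem norm_sq_sub_add_norm_sq {n : ℕ} (a b : ℝ) (hab : 0 < a + b)
    (ξ v : EuclideanSpace ℝ (Fin n)) :
    a * ‖ξ - v‖ ^ 2 + b * ‖ξ‖ ^ 2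
      = (a + b) * ‖ξ - (a / (a + b)) • v‖ ^ 2 + a * b / (a + b) * ‖v‖ ^ 2 := by
  rw [norm_sub_sq_real, norm_sub_sq_real, inner_smul_right, norm_smul, mul_pow,
    Real.norm_eq_abs, sq_abs]
  field_simp
  ring

theorem lintegral_gaussian_mul_gaussian (n : ℕ) {a b : ℝ} (ha : 0 < a) (hb : 0 < b)
    (v : EuclideanSpace ℝ (Fin n)) :
    ∫⁻ ξ : EuclideanSpace ℝ (Fin n), ENNReal.ofReal (Real.exp (-(a * ‖ξ - v‖ ^ 2 + b * ‖ξ‖ ^ 2)))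
      = ENNReal.ofReal (Real.exp (-(a * b / (a + b) * ‖v‖ ^ 2))
          * (Real.pi / (a + b)) ^ ((n : ℝ) / 2)) := by
  have hab : 0 < a + b := by linarith
  have h2 : ∀ ξ : EuclideanSpace ℝ (Fin n),
      ENNReal.ofReal (Real.exp (-(a * ‖ξ - v‖ ^ 2 + b * ‖ξ‖ ^ 2)))
        = ENNReal.ofReal (Real.exp (-(a * b / (a + b) * ‖v‖ ^ 2)))
          * ENNReal.ofReal (Real.exp (-(a + b) * ‖ξ - (a / (a + b)) • v‖ ^ 2)) := by
    intro ξ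
    rw [← ENNReal.ofReal_mul (by positivity), ← Real.exp_add, norm_sq_sub_add_norm_sq a b hab]
    congr 2
    ring
  simp only [h2]
  rw [lintegral_const_mul _ (by fun_prop), lintegral_gaussian n hab,
    ← ENNReal.ofReal_mul (by positivity)]

/-! ### Young's convolution inequality -/

/-- A pointwise form of Young's convolution inequality: `p ≤ q`, `r ≤ q` and
`1 + 1/q = 1/p + 1/r`. -/
theorem lintegral_mul_rpow_le {X : Type*} [MeasurableSpace X] {μ : Measure X}
    {k g : X → ENNReal} (hk : AEMeasurable k μ) (hg : AEMeasurable g μ) {p q r : ℝ}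
    (hp : 1 ≤ p) (hr : 1 ≤ r) (hpq : p ≤ q) (hrq : r ≤ q) (h : 1 + 1 / q = 1 / p + 1 / r) :
    (∫⁻ y, k y * g y ∂μ) ^ q ≤ (∫⁻ y, k y ^ r * g y ^ p ∂μ)
      * ((∫⁻ y, k y ^ r ∂μ) ^ (1 / r - 1 / q) * (∫⁻ y, g y ^ p ∂μ) ^ (1 / p - 1 / q)) ^ q := by
  have hq : 0 < q := by linarith
  have hqr : 0 ≤ 1 / r - 1 / q := sub_nonneg.2 (one_div_le_one_div_of_le (by linarith) hrq)
  have hqp : 0 ≤ 1 / p - 1 / q := sub_nonneg.2 (one_div_le_one_div_of_le (by linarith) hpq)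
  -- Hölder for three factors: the weights `1/q`, `1/r - 1/q`, `1/p - 1/q` sum to one exactly by the
  -- Young relation.
  have H := ENNReal.lintegral_prod_norm_pow_le (μ := μ) (Finset.univ : Finset (Fin 3))
    (f := ![fun y => k y ^ r * g y ^ p, fun y => k y ^ r, fun y => g y ^ p])
    (by
      intro i _
      fin_cases i
      · exact (hk.pow_const r).mul (hg.pow_const p)
      · exact hk.pow_const r
      · exact hg.pow_const p)
    (p := ![1 / q, 1 / r - 1 / q, 1 / p - 1 / q])
    (by
      simp only [Fin.sum_univ_three, Matrix.cons_val]
      linarith)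
    (by
      intro i _
      fin_cases i
      · exact (one_div_pos.2 hq).le
      · exact hqr
      · exact hqp)
  simp only [Fin.prod_univ_three, Matrix.cons_val] at H
  have hpt : ∀ y, k y * g y
      = (k y ^ r * g y ^ p) ^ (1 / q) * (k y ^ r) ^ (1 / r - 1 / q)
        * (g y ^ p) ^ (1 / p - 1 / q) := by
    intro y
    rw [ENNReal.mul_rpow_of_nonneg _ _ (one_div_pos.2 hq).le]
    simp only [← ENNReal.rpow_mul]
    rw [mul_right_comm _ _ (k y ^ _), mul_assoc, ← ENNReal.rpow_add_of_nonneg _ _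
      (mul_nonneg (by linarith) (one_div_pos.2 hq).le) (mul_nonneg (by linarith) hqr),
      ← ENNReal.rpow_add_of_nonneg _ _
      (mul_nonneg (by linarith) (one_div_pos.2 hq).le) (mul_nonneg (by linarith) hqp),
      ← mul_add, ← mul_add, add_sub_cancel, add_sub_cancel, mul_one_div_cancel (by linarith),
      mul_one_div_cancel (by linarith), ENNReal.rpow_one, ENNReal.rpow_one]
  calc (∫⁻ y, k y * g y ∂μ) ^ q
      ≤ ((∫⁻ y, k y ^ r * g y ^ p ∂μ) ^ (1 / q) * (∫⁻ y, k y ^ r ∂μ) ^ (1 / r - 1 / q)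
        * (∫⁻ y, g y ^ p ∂μ) ^ (1 / p - 1 / q)) ^ q := by
        refine ENNReal.rpow_le_rpow ?_ hq.le
        simp only [hpt]
        exact H
    _ = _ := by
        rw [mul_assoc, ENNReal.mul_rpow_of_nonneg _ _ hq.le, ← ENNReal.rpow_mul,
          one_div_mul_cancel hq.ne', ENNReal.rpow_one]

/-- Young's convolution inequality for nonnegative functions on a group. -/
theorem lintegral_convolution_rpow_le {G : Type*} [MeasurableSpace G] [AddGroup G]
    [MeasurableAdd₂ G] [MeasurableNeg G] {μ : Measure G} [SFinite μ] [μ.IsAddLeftInvariant]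
    [μ.IsAddRightInvariant]
    [μ.IsNegInvariant] {k g : G → ENNReal} (hk : Measurable k) (hg : Measurable g) {p q r : ℝ}
    (hp : 1 ≤ p) (hr : 1 ≤ r) (hpq : p ≤ q) (hrq : r ≤ q) (h : 1 + 1 / q = 1 / p + 1 / r) :
    ∫⁻ z, (∫⁻ y, k (z - y) * g y ∂μ) ^ q ∂μ
      ≤ (∫⁻ y, k y ^ r ∂μ) ^ (q / r) * (∫⁻ y, g y ^ p ∂μ) ^ (q / p) := by
  have hq : 0 < q := by linarith
  have hqr : 0 ≤ 1 / r - 1 / q := sub_nonneg.2 (one_div_le_one_div_of_le (by linarith) hrq)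
  have hqp : 0 ≤ 1 / p - 1 / q := sub_nonneg.2 (one_div_le_one_div_of_le (by linarith) hpq)
  set A := ∫⁻ y, k y ^ r ∂μ with hA
  set B := ∫⁻ y, g y ^ p ∂μ with hB
  have hkz : ∀ z, ∫⁻ y, k (z - y) ^ r ∂μ = A := fun z =>
    lintegral_sub_left_eq_self (fun y => k y ^ r) z
  have hsub : Measurable fun w : G × G => w.1 - w.2 := measurable_fst.sub measurable_snd
  have h1 : ∀ z, (∫⁻ y, k (z - y) * g y ∂μ) ^ q
      ≤ (∫⁻ y, k (z - y) ^ r * g y ^ p ∂μ)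
        * (A ^ (1 / r - 1 / q) * B ^ (1 / p - 1 / q)) ^ q := by
    intro z
    have := lintegral_mul_rpow_le (μ := μ) (k := fun y => k (z - y)) (g := g)
      (hk.comp (measurable_const.sub measurable_id)).aemeasurable hg.aemeasurable hp hr hpq hrq h
    rwa [hkz z] at this
  have hm : Measurable fun w : G × G => k (w.1 - w.2) ^ r * g w.2 ^ p :=
    ((hk.comp hsub).pow_const r).mul ((hg.comp measurable_snd).pow_const p)
  calc ∫⁻ z, (∫⁻ y, k (z - y) * g y ∂μ) ^ q ∂μ
      ≤ ∫⁻ z, (∫⁻ y, k (z - y) ^ r * g y ^ p ∂μ)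
        * (A ^ (1 / r - 1 / q) * B ^ (1 / p - 1 / q)) ^ q ∂μ := lintegral_mono h1
    _ = (∫⁻ z, ∫⁻ y, k (z - y) ^ r * g y ^ p ∂μ ∂μ)
        * (A ^ (1 / r - 1 / q) * B ^ (1 / p - 1 / q)) ^ q :=
        lintegral_mul_const _ hm.lintegral_prod_right'
    _ = (A * B) * (A ^ (1 / r - 1 / q) * B ^ (1 / p - 1 / q)) ^ q := by
        congr 1
        rw [lintegral_lintegral_swap hm.aemeasurable, hB, ← lintegral_const_mul _ (hg.pow_const p)]
        refine lintegral_congr fun y => ?_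
        have hky : Measurable fun z => k (z - y) ^ r :=
          (hk.comp (measurable_id.sub measurable_const)).pow_const r
        rw [lintegral_mul_const _ hky,
          lintegral_sub_right_eq_self (fun z => k z ^ r) y]
    _ = A ^ (q / r) * B ^ (q / p) := by
        rw [ENNReal.mul_rpow_of_nonneg _ _ hq.le, ← ENNReal.rpow_mul, ← ENNReal.rpow_mul,
          mul_mul_mul_comm]
        have e1 : q / r = 1 + (1 / r - 1 / q) * q := by field_simp; ring
        have e2 : q / p = 1 + (1 / p - 1 / q) * q := by field_simp; ring
        rw [e1, e2, ENNReal.rpow_add_of_nonneg _ _ zero_le_one (by positivity),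
          ENNReal.rpow_add_of_nonneg _ _ zero_le_one (by positivity), ENNReal.rpow_one,
          ENNReal.rpow_one]

/-! ### Nonexistence above the curve -/

/-- The exponent of `δ` is positive, so the kernel restricted to short time lags has small `L^r`
norm. -/
theorem lintegral_indicator_fracHeatKernel_rpow (n : ℕ) {α r δ : ℝ} (hα : 0 < α) (hr : 0 < r)
    (hδ : 0 ≤ δ) (hγ : 0 < r * (α - 1 - (n : ℝ) / 2) + (n : ℝ) / 2 + 1) :
    ∫⁻ z : SpaceTime n, ((Set.univ ×ˢ Set.Iio δ).indicator
      (fun z => ENNReal.ofReal (fracHeatKernel n α z)) z) ^ r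
      = ENNReal.ofReal (fracHeatConst n α ^ r) * ENNReal.ofReal ((Real.pi / (r / 4)) ^ ((n : ℝ) / 2)
          * (δ ^ (r * (α - 1 - (n : ℝ) / 2) + (n : ℝ) / 2 + 1)
            / (r * (α - 1 - (n : ℝ) / 2) + (n : ℝ) / 2 + 1))) := by
  have hc := fracHeatConst_pos n hα
  rw [← lintegral_strip_gaussian n (by linarith) (by positivity) hδ,
    ← lintegral_indicator (MeasurableSet.univ.prod measurableSet_Ioo),
    ← lintegral_const_mul _ (Measurable.indicator (by fun_prop)
      (MeasurableSet.univ.prod measurableSet_Ioo))]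
  refine lintegral_congr fun z => ?_
  by_cases hz : 0 < z.2
  · by_cases hz2 : z.2 < δ
    · rw [Set.indicator_of_mem (by simpa using hz2), Set.indicator_of_mem (by simpa using ⟨hz, hz2⟩),
        ENNReal.ofReal_rpow_of_nonneg (fracHeatKernel_nonneg n hα z) hr.le,
        ← ENNReal.ofReal_mul (by positivity), fracHeatKernel_of_pos n α z hz,
        Real.mul_rpow (by positivity) (by positivity), Real.mul_rpow (by positivity) (by positivity),
        ← Real.rpow_mul hz.le, ← Real.exp_mul, mul_comm (_ - _) r, mul_assoc]
      congr 4
      field_simp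
    · rw [Set.indicator_of_notMem (by simpa using hz2), Set.indicator_of_notMem
        (by simpa using fun _ => not_lt.1 hz2), ENNReal.zero_rpow_of_pos hr, mul_zero]
  · rw [Set.indicator_of_notMem (s := Set.univ ×ˢ Set.Ioo 0 δ)
        (by simpa using fun h => absurd h hz), mul_zero]
    rw [Set.indicator_apply, fracHeatKernel_of_nonpos n α z (not_lt.1 hz)]
    simp [hr]

/-- One step of the march in time. Young's inequality bounds the mass `A` before `s'` by a constant
times `A ^ lam`; splitting off `A ^ (lam - 1)`, which the mass before `T` controls, leaves a factor
below `1` by `hδ`. -/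
theorem ae_eq_zero_of_le_heatPot_rpow_step (n : ℕ) {α p lam r : ℝ} (hp : 1 ≤ p)
    (hlam : 1 ≤ lam) (hr : 1 ≤ r) (hrq : r ≤ p * lam)
    (hconj : 1 + 1 / (p * lam) = 1 / p + 1 / r) {F : SpaceTime n → ENNReal} (hF : Measurable F)
    {C : ENNReal} (hle : ∀ᵐ z, F z ≤ C * heatPot n α F z ^ lam)
    {T δ s s' : ℝ} (hfin : ∫⁻ z in Set.univ ×ˢ Set.Iio T, F z ^ p ≠ ⊤)
    (hδ : C ^ p * (∫⁻ z : SpaceTime n, ((Set.univ ×ˢ Set.Iio δ).indicator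
      (fun z => ENNReal.ofReal (fracHeatKernel n α z)) z) ^ r) ^ (p * lam / r)
        * (∫⁻ z in Set.univ ×ˢ Set.Iio T, F z ^ p) ^ (lam - 1) < 1)
    (hs : s' ≤ s + δ) (hsT : s' ≤ T) (h0 : ∀ᵐ z, z.2 < s → F z = 0) :
    ∀ᵐ z, z.2 < s' → F z = 0 := by
  have hp0 : 0 < p := by linarith
  have hSm : MeasurableSet ((Set.univ : Set (EuclideanSpace ℝ (Fin n))) ×ˢ Set.Iio s') :=
    MeasurableSet.univ.prod measurableSet_Iio
  set k : SpaceTime n → ENNReal := (Set.univ ×ˢ Set.Iio δ).indicator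
      (fun z => ENNReal.ofReal (fracHeatKernel n α z)) with hk
  have hkm : Measurable k := (measurable_fracHeatKernel n α).ennreal_ofReal.indicator
    (MeasurableSet.univ.prod measurableSet_Iio)
  set G : SpaceTime n → ENNReal := (Set.univ ×ˢ Set.Iio s').indicator F with hG
  have hGm : Measurable G := hF.indicator hSm
  -- The source vanishes before `s` and `s' ≤ s + δ`, so only lags below `δ` contribute and the
  -- truncated kernel loses nothing.
  have hpot : ∀ z : SpaceTime n, z.2 < s' → heatPot n α F z ≤ ∫⁻ y, k (z - y) * G y := by
    intro z hz
    refine lintegral_mono_ae ?_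
    filter_upwards [h0] with y hy
    rcases lt_or_ge y.2 s with h | h
    · simp [hy h]
    · rcases lt_or_ge y.2 s' with h' | h'
      · have h1 : z - y ∈ (Set.univ : Set (EuclideanSpace ℝ (Fin n))) ×ˢ Set.Iio δ := by
          simp only [Set.mem_prod, Set.mem_univ, true_and, Set.mem_Iio, Prod.snd_sub]
          linarith
        have h2 : y ∈ (Set.univ : Set (EuclideanSpace ℝ (Fin n))) ×ˢ Set.Iio s' := by simpa using h'
        rw [hG, hk, Set.indicator_of_mem h1, Set.indicator_of_mem h2]
      · rw [fracHeatKernel_of_nonpos n α (z - y) (by simp only [Prod.snd_sub]; linarith)]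
        simp
  set A := ∫⁻ z, G z ^ p with hA
  set M := ∫⁻ z in Set.univ ×ˢ Set.Iio T, F z ^ p with hM
  have hGp : ∀ z, G z ^ p = (Set.univ ×ˢ Set.Iio s').indicator (fun z => F z ^ p) z := by
    intro z
    rw [hG]
    by_cases h : z ∈ (Set.univ : Set (EuclideanSpace ℝ (Fin n))) ×ˢ Set.Iio s'
    · rw [Set.indicator_of_mem h, Set.indicator_of_mem h]
    · rw [Set.indicator_of_notMem h, Set.indicator_of_notMem h, ENNReal.zero_rpow_of_pos hp0]
  have hAS : A = ∫⁻ z in Set.univ ×ˢ Set.Iio s', F z ^ p := by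
    rw [hA, ← lintegral_indicator hSm]
    exact lintegral_congr hGp
  have hAM : A ≤ M := by
    rw [hAS]
    exact lintegral_mono_set (Set.prod_mono_right (Set.Iio_subset_Iio hsT))
  have hAfin : A ≠ ⊤ := ne_top_of_le_ne_top hfin hAM
  have hbound : A ≤ C ^ p * (∫⁻ z, k z ^ r) ^ (p * lam / r) * A ^ lam := by
    calc A ≤ ∫⁻ z, C ^ p * (∫⁻ y, k (z - y) * G y) ^ (p * lam) := by
          refine lintegral_mono_ae ?_
          filter_upwards [hle] with z hz
          by_cases h : z.2 < s'
          · rw [hG, Set.indicator_of_mem (by simpa using h)]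
            calc F z ^ p ≤ (C * heatPot n α F z ^ lam) ^ p := ENNReal.rpow_le_rpow hz hp0.le
              _ ≤ (C * (∫⁻ y, k (z - y) * G y) ^ lam) ^ p := by
                  gcongr
                  exact hpot z h
              _ = _ := by
                  rw [ENNReal.mul_rpow_of_nonneg _ _ hp0.le, ← ENNReal.rpow_mul, mul_comm lam p]
          · rw [hG, Set.indicator_of_notMem (by simpa using h), ENNReal.zero_rpow_of_pos hp0]
            exact zero_le
      _ = C ^ p * ∫⁻ z, (∫⁻ y, k (z - y) * G y) ^ (p * lam) := by
          refine lintegral_const_mul _ (Measurable.pow_const ?_ _)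
          exact Measurable.lintegral_prod_right' (f := fun w : SpaceTime n × SpaceTime n =>
            k (w.1 - w.2) * G w.2) ((hkm.comp (measurable_fst.sub measurable_snd)).mul
              (hGm.comp measurable_snd))
      _ ≤ C ^ p * ((∫⁻ z, k z ^ r) ^ (p * lam / r) * A ^ (p * lam / p)) := by
          gcongr
          exact lintegral_convolution_rpow_le hkm hGm hp hr (le_mul_of_one_le_right hp0.le hlam)
            hrq hconj
      _ = _ := by rw [mul_div_cancel_left₀ _ hp0.ne', mul_assoc]
  have hA0 : A = 0 := by
    by_contra hne
    have h1 : A ^ lam ≤ M ^ (lam - 1) * A := by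
      calc A ^ lam = A ^ (lam - 1) * A ^ (1 : ℝ) := by
            rw [← ENNReal.rpow_add_of_nonneg _ _ (by linarith) zero_le_one, sub_add_cancel]
        _ ≤ _ := by
            rw [ENNReal.rpow_one]
            gcongr
    have h2 : A < 1 * A := by
      calc A ≤ C ^ p * (∫⁻ z, k z ^ r) ^ (p * lam / r) * (M ^ (lam - 1) * A) :=
            hbound.trans (by gcongr)
        _ = (C ^ p * (∫⁻ z, k z ^ r) ^ (p * lam / r) * M ^ (lam - 1)) * A := by ring
        _ < 1 * A := ENNReal.mul_lt_mul_left hne hAfin hδ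
    rw [one_mul] at h2
    exact lt_irrefl _ h2
  rw [hA, lintegral_eq_zero_iff (hGm.pow_const p)] at hA0
  filter_upwards [hA0] with z hz h
  have : G z = 0 := by
    simpa [ENNReal.rpow_eq_zero_iff, hp0, hp0.not_gt] using hz
  rwa [hG, Set.indicator_of_mem (by simpa using h)] at this

/-- Supercritical smoothing: a function that vanishes for negative times and is dominated by a
power of its potential vanishes. -/
theorem ae_eq_zero_of_le_heatPot_rpow (n : ℕ) {α p lam : ℝ} (hα : 0 < α) (hp : 1 ≤ p)
    (hlam : 1 ≤ lam) (hcrit : ((n : ℝ) + 2) / (2 * p) * (1 - 1 / lam) < α)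
    {F : SpaceTime n → ENNReal} (hF : Measurable F)
    {C : ENNReal} (hC : C ≠ ⊤) (hle : ∀ᵐ z, F z ≤ C * heatPot n α F z ^ lam)
    (hfin : ∀ T : ℝ, ∫⁻ z in Set.univ ×ˢ Set.Iio T, F z ^ p ≠ ⊤)
    (h0 : ∀ᵐ z, z.2 < 0 → F z = 0) : ∀ᵐ z, F z = 0 := by
  have hp0 : 0 < p := by linarith
  have hl0 : 0 < lam := by linarith
  have hl1 : 0 < 1 / lam := by positivity
  have hl2 : 1 / lam ≤ 1 := (div_le_one hl0).2 hlam
  have hp2 : 1 / p ≤ 1 := (div_le_one hp0).2 hp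
  have hp1 : 0 < 1 / p := by positivity
  -- The reciprocal of `r`, solved from the Young relation with `q = p * lam`.
  set i := 1 - 1 / p * (1 - 1 / lam) with hi
  have hi0 : 0 < i := by nlinarith
  have hi1 : i ≤ 1 := by nlinarith
  have hiq : 1 / (p * lam) ≤ i := by
    rw [show 1 / (p * lam) = 1 / p * (1 / lam) by field_simp]
    nlinarith
  set r := 1 / i with hr
  have hri : 1 / r = i := by rw [hr, one_div_one_div]
  have hr0 : 0 < r := by positivity
  have hr1 : 1 ≤ r := by rw [hr, le_div_iff₀ hi0]; linarith
  have hrq : r ≤ p * lam := by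
    rw [← one_div_one_div (p * lam)]
    exact one_div_le_one_div_of_le (by positivity) hiq
  have hconj : 1 + 1 / (p * lam) = 1 / p + 1 / r := by
    rw [hri, hi]
    field_simp
    ring
  set γ := r * (α - 1 - (n : ℝ) / 2) + (n : ℝ) / 2 + 1 with hγd
  have hγ : 0 < γ := by
    -- The power of `δ` is `r` times the height of `α` above the curve: this is where the curve
    -- enters.
    have h1 : γ = r * (α - ((n : ℝ) + 2) / (2 * p) * (1 - 1 / lam)) := by
      have : r * i = 1 := by rw [hr]; field_simp
      have h2 : ((n : ℝ) + 2) / (2 * p) * (1 - 1 / lam) = ((n : ℝ) + 2) / 2 * (1 - i) := by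
        rw [hi]
        field_simp
        ring
      rw [h2, hγd]
      linear_combination (-((n : ℝ) + 2) / 2) * this
    rw [h1]
    exact mul_pos hr0 (by linarith)
  have hT : ∀ T : ℝ, ∀ᵐ z : SpaceTime n, z.2 < T → F z = 0 := by
    intro T
    obtain ⟨δ, hδ0, hδ⟩ : ∃ δ : ℝ, 0 < δ ∧ C ^ p *
        (∫⁻ z : SpaceTime n, ((Set.univ ×ˢ Set.Iio δ).indicator
        (fun z => ENNReal.ofReal (fracHeatKernel n α z)) z) ^ r) ^ (p * lam / r)
        * (∫⁻ z in Set.univ ×ˢ Set.Iio T, F z ^ p) ^ (lam - 1) < 1 := by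
      have hlim : Filter.Tendsto (fun δ : ℝ => C ^ p *
          (ENNReal.ofReal (fracHeatConst n α ^ r) *
            ENNReal.ofReal ((Real.pi / (r / 4)) ^ ((n : ℝ) / 2) * (δ ^ γ / γ))) ^ (p * lam / r)
          * (∫⁻ z in Set.univ ×ˢ Set.Iio T, F z ^ p) ^ (lam - 1)) (nhds 0) (nhds 0) := by
        have h1 : Filter.Tendsto (fun δ : ℝ => ENNReal.ofReal
            ((Real.pi / (r / 4)) ^ ((n : ℝ) / 2) * (δ ^ γ / γ))) (nhds 0) (nhds 0) := by
          have hc : Continuous fun δ : ℝ => ENNReal.ofReal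
              ((Real.pi / (r / 4)) ^ ((n : ℝ) / 2) * (δ ^ γ / γ)) :=
            ENNReal.continuous_ofReal.comp (continuous_const.mul
              ((Real.continuous_rpow_const hγ.le).div_const γ))
          have := hc.tendsto 0
          simpa [Real.zero_rpow hγ.ne'] using this
        have h2 := ENNReal.Tendsto.const_mul (a := ENNReal.ofReal (fracHeatConst n α ^ r)) h1
          (Or.inr ENNReal.ofReal_ne_top)
        have h3 := ((ENNReal.continuous_rpow_const (y := p * lam / r)).tendsto _).comp h2
        have h4 := ENNReal.Tendsto.const_mul (a := C ^ p) h3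
          (Or.inr (ENNReal.rpow_ne_top_of_nonneg hp0.le hC))
        have h5 := ENNReal.Tendsto.mul_const
          (b := (∫⁻ z in Set.univ ×ˢ Set.Iio T, F z ^ p) ^ (lam - 1)) h4
          (Or.inr (ENNReal.rpow_ne_top_of_nonneg (by linarith) (hfin T)))
        have hexp : 0 < p * lam / r := by positivity
        simpa [Function.comp_def, hexp] using h5
      have hev := (hlim.mono_left (nhdsWithin_le_nhds (s := Set.Ioi 0))).eventually_lt_const
        zero_lt_one
      obtain ⟨δ, h1, h2⟩ := (hev.and self_mem_nhdsWithin).exists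
      refine ⟨δ, h2, ?_⟩
      rw [lintegral_indicator_fracHeatKernel_rpow n hα hr0 (le_of_lt h2) hγ]
      exact h1
    -- The step length `δ` depends only on the mass before `T`, so it stays fixed throughout the
    -- march up to `T`.
    have hk : ∀ k : ℕ, ∀ᵐ z : SpaceTime n, z.2 < min (k * δ) T → F z = 0 := by
      intro k
      induction k with
      | zero =>
        filter_upwards [h0] with z hz h
        exact hz (by simpa using (lt_min_iff.1 h).1)
      | succ k ih =>
        refine ae_eq_zero_of_le_heatPot_rpow_step n hp hlam hr1 hrq hconj hF hle (hfin T) hδ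
          ?_ (min_le_right _ _) ih
        rw [← min_add_add_right]
        push_cast
        exact le_min ((min_le_left _ _).trans (by linarith)) ((min_le_right _ _).trans (by linarith))
    filter_upwards [ae_all_iff.2 hk] with z hz h
    obtain ⟨k, hk'⟩ := exists_nat_gt (T / δ)
    refine hz k (lt_min ?_ h)
    rw [div_lt_iff₀ hδ0] at hk'
    linarith
  have hN : ∀ N : ℕ, ∀ᵐ z : SpaceTime n, z.2 < N → F z = 0 := fun N => hT N
  filter_upwards [ae_all_iff.2 hN] with z hz
  obtain ⟨N, h⟩ := exists_nat_gt z.2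
  exact hz N h

/-! ### Lower bounds for the potential -/

theorem const_mul_measure_le_lintegral {X : Type*} [MeasurableSpace X] {μ : Measure X}
    {S : Set X} (hS : MeasurableSet S) {c : ENNReal} {g : X → ENNReal}
    (h : ∀ᵐ y ∂μ, y ∈ S → c ≤ g y) : c * μ S ≤ ∫⁻ y in S, g y ∂μ := by
  rw [← setLIntegral_const]
  exact lintegral_mono_ae ((ae_restrict_iff' hS).2 h)

/-- The volume of the unit ball. -/
noncomputable def unitBallVolume (n : ℕ) : ℝ :=
  (volume (Metric.ball (0 : EuclideanSpace ℝ (Fin n)) 1)).toReal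

theorem unitBallVolume_pos (n : ℕ) : 0 < unitBallVolume n :=
  ENNReal.toReal_pos (Metric.measure_ball_pos _ _ one_pos).ne' measure_ball_lt_top.ne

theorem volume_ball_prod_Ioo (n : ℕ) (x : EuclideanSpace ℝ (Fin n)) {r : ℝ} (hr : 0 < r)
    (a b : ℝ) :
    volume (Metric.ball x r ×ˢ Set.Ioo a b : Set (SpaceTime n))
      = ENNReal.ofReal (r ^ n * unitBallVolume n * (b - a)) := by
  have := unitBallVolume_pos n
  rw [Measure.volume_eq_prod, Measure.prod_prod, Real.volume_Ioo,
    Measure.addHaar_ball_of_pos _ _ hr, finrank_euclideanSpace_fin,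
    ENNReal.ofReal_mul (by positivity), ENNReal.ofReal_mul (by positivity), unitBallVolume,
    ENNReal.ofReal_toReal measure_ball_lt_top.ne]

/-- A lower bound of the source on a short cylinder below `(x, t)` gives a lower bound of the
potential, with a constant independent of the cylinder. -/
theorem exists_le_heatPot_of_le (n : ℕ) {α : ℝ} (hα : 0 < α) :
    ∃ κ : ℝ, 0 < κ ∧ ∀ (F : SpaceTime n → ENNReal) (x₀ : EuclideanSpace ℝ (Fin n)) (R δ t : ℝ)
      (m : ENNReal), 0 < R → 0 < δ → δ ≤ R ^ 2 → ∀ x ∈ Metric.ball x₀ R,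
      (∀ᵐ y : SpaceTime n, y.1 ∈ Metric.ball x₀ R → y.2 ∈ Set.Ioo (t - δ) t → m ≤ F y) →
      ENNReal.ofReal (κ * δ ^ α) * m ≤ heatPot n α F (x, t) := by
  obtain ⟨κ, hκ, hker⟩ := exists_le_fracHeatKernel n hα (B := 2) (by norm_num)
  have hV := unitBallVolume_pos n
  refine ⟨κ * ((1 / 2) ^ n * unitBallVolume n * (1 / 2)), by positivity, ?_⟩
  intro F x₀ R δ t m hR hδ hδR x hx hF
  -- The ball of radius `d` about `x'`, which is `x` moved by less than `d` towards `x₀`, stays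
  -- inside the large ball and within `√δ` of `x`, even when `x` is near the boundary.
  set d := Real.sqrt δ / 2 with hd
  have hd0 : 0 < d := by positivity
  have hd2 : (2 * d) ^ 2 = δ := by
    rw [hd, mul_div_cancel₀ _ two_ne_zero, Real.sq_sqrt hδ.le]
  have hdR : 2 * d ≤ R := by
    rw [← hd2] at hδR
    exact (sq_le_sq₀ (by positivity) hR.le).1 hδR
  set x' := x + (d / R) • (x₀ - x) with hx'
  have hxx : ‖x - x₀‖ < R := by simpa [dist_eq_norm] using hx
  have h1 : ‖x' - x₀‖ < R - d := by
    have : x' - x₀ = (1 - d / R) • (x - x₀) := by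
      rw [hx']
      module
    have h0 : 0 < 1 - d / R := by
      rw [sub_pos, div_lt_one hR]
      linarith
    rw [this, norm_smul, Real.norm_of_nonneg h0.le]
    calc (1 - d / R) * ‖x - x₀‖ < (1 - d / R) * R := by gcongr
      _ = R - d := by field_simp
  have h2 : ‖x' - x‖ ≤ d := by
    rw [hx', add_sub_cancel_left, norm_smul, Real.norm_of_nonneg (by positivity), norm_sub_rev]
    calc d / R * ‖x - x₀‖ ≤ d / R * R := by gcongr
      _ = d := by field_simp
  have hS : MeasurableSet (Metric.ball x' d ×ˢ Set.Ioo (t - δ) (t - δ / 2) :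
      Set (SpaceTime n)) := Metric.isOpen_ball.measurableSet.prod measurableSet_Ioo
  have key := const_mul_measure_le_lintegral (μ := volume) hS
    (c := ENNReal.ofReal (κ * δ ^ (α - 1 - (n : ℝ) / 2)) * m)
    (g := fun y => ENNReal.ofReal (fracHeatKernel n α ((x, t) - y)) * F y) (by
      filter_upwards [hF] with y hy hyS
      obtain ⟨hy1, hy2⟩ := hyS
      have hy1' : ‖y.1 - x'‖ < d := by simpa [dist_eq_norm] using hy1
      have hyx : ‖y.1 - x₀‖ < R := by
        calc ‖y.1 - x₀‖ = ‖(y.1 - x') + (x' - x₀)‖ := by congr 1; abel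
          _ ≤ ‖y.1 - x'‖ + ‖x' - x₀‖ := norm_add_le _ _
          _ < R := by linarith
      have hyx2 : ‖x - y.1‖ ≤ 2 * d := by
        calc ‖x - y.1‖ = ‖(y.1 - x') + (x' - x)‖ := by rw [norm_sub_rev]; congr 1; abel
          _ ≤ ‖y.1 - x'‖ + ‖x' - x‖ := norm_add_le _ _
          _ ≤ 2 * d := by linarith
      refine mul_le_mul' (ENNReal.ofReal_le_ofReal (hker δ hδ _ ?_ ?_ ?_))
        (hy (by simpa [dist_eq_norm] using hyx) ⟨hy2.1, by linarith [hy2.2]⟩)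
      · simp only [Prod.snd_sub]
        linarith [hy2.2]
      · simp only [Prod.snd_sub]
        linarith [hy2.1]
      · simp only [Prod.fst_sub]
        calc ‖x - y.1‖ ^ 2 ≤ (2 * d) ^ 2 := by gcongr
          _ ≤ 2 * δ := by linarith)
  refine le_trans ?_ (key.trans (setLIntegral_le_lintegral _ _))
  rw [volume_ball_prod_Ioo n x' hd0, mul_right_comm (ENNReal.ofReal _) m,
    ← ENNReal.ofReal_mul (by positivity)]
  refine mul_le_mul_left (ENNReal.ofReal_le_ofReal (le_of_eq ?_)) _
  have hdn : d ^ n = (1 / 2) ^ n * δ ^ ((n : ℝ) / 2) := by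
    rw [hd, div_eq_mul_one_div, mul_pow, mul_comm, Real.sqrt_eq_rpow, ← Real.rpow_natCast,
      ← Real.rpow_natCast, ← Real.rpow_mul hδ.le]
    congr 2
    ring
  have hδα : δ ^ α = δ ^ (α - 1 - (n : ℝ) / 2) * δ ^ ((n : ℝ) / 2) * δ := by
    rw [← Real.rpow_add hδ, ← Real.rpow_add_one hδ.ne']
    congr 1
    ring
  rw [hdn, hδα]
  ring

/-- The parabolic cylinder of radius `R` centred at the origin. -/
def parabolicCylinder (n : ℕ) (R : ℝ) : Set (SpaceTime n) :=
  Metric.ball 0 R ×ˢ Set.Ioo (-R ^ 2) (R ^ 2)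

theorem measurableSet_parabolicCylinder (n : ℕ) (R : ℝ) :
    MeasurableSet (parabolicCylinder n R) :=
  Metric.isOpen_ball.measurableSet.prod measurableSet_Ioo

/-- Every point of the cylinder is seen from `(x, t)` with a time lag between `R ^ 2` and `5 * R ^
2` and at distance at most `(B + 1) * R`, so the kernel has its self-similar size there. -/
theorem exists_mass_le_heatPot (n : ℕ) {α : ℝ} (hα : 0 < α) {B : ℝ} (hB : 0 ≤ B) :
    ∃ κ : ℝ, 0 < κ ∧ ∀ (F : SpaceTime n → ENNReal) (R : ℝ), 0 < R →
      ∀ (x : EuclideanSpace ℝ (Fin n)) (t : ℝ), ‖x‖ ≤ B * R → 2 * R ^ 2 ≤ t → t ≤ 4 * R ^ 2 →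
      ENNReal.ofReal (κ * R ^ (2 * (α - 1 - (n : ℝ) / 2))) * ∫⁻ y in parabolicCylinder n R, F y
        ≤ heatPot n α F (x, t) := by
  obtain ⟨κ, hκ, hker⟩ := exists_le_fracHeatKernel n hα (B := (B + 1) ^ 2 + 5)
    (by nlinarith [sq_nonneg (B + 1)])
  refine ⟨κ, hκ, ?_⟩
  intro F R hR x t hx ht1 ht2
  rw [Real.rpow_mul hR.le, Real.rpow_two]
  have hR2 : 0 < R ^ 2 := by positivity
  rw [← lintegral_const_mul' _ _ ENNReal.ofReal_ne_top]
  refine le_trans ?_ (setLIntegral_le_lintegral (parabolicCylinder n R) _)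
  refine setLIntegral_mono_ae' (measurableSet_parabolicCylinder n R)
    (Filter.Eventually.of_forall fun y hy => ?_)
  obtain ⟨hy1, hy2⟩ := hy
  have hy1' : ‖y.1‖ < R := by simpa using hy1
  refine mul_le_mul_left (ENNReal.ofReal_le_ofReal (hker _ hR2 _ ?_ ?_ ?_)) _
  · simp only [Prod.snd_sub]
    calc R ^ 2 / ((B + 1) ^ 2 + 5) ≤ R ^ 2 :=
          div_le_self hR2.le (by nlinarith [sq_nonneg (B + 1)])
      _ ≤ t - y.2 := by linarith [hy2.2]
  · simp only [Prod.snd_sub]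
    have : 0 ≤ (B + 1) ^ 2 * R ^ 2 := by positivity
    linarith [hy2.1]
  · simp only [Prod.fst_sub]
    calc ‖x - y.1‖ ^ 2 ≤ (B * R + R) ^ 2 := by
          gcongr
          exact (norm_sub_le _ _).trans (by linarith)
      _ ≤ ((B + 1) ^ 2 + 5) * R ^ 2 := by nlinarith

/-- The cylinders exhaust space-time. The bound `1 ≤ R` later lets the unit time interval after `2 *
R ^ 2` end before `4 * R ^ 2`. -/
theorem exists_mass_pos (n : ℕ) {F : SpaceTime n → ENNReal} (hF : Measurable F)
    (hne : ¬ ∀ᵐ z, F z = 0) :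
    ∃ R : ℝ, 1 ≤ R ∧ 0 < ∫⁻ y in parabolicCylinder n R, F y := by
  by_contra! hc
  apply hne
  have h : ∀ k : ℕ, ∀ᵐ z, z ∈ parabolicCylinder n ((k : ℝ) + 1) → F z = 0 := by
    intro k
    have := nonpos_iff_eq_zero.1 (hc ((k : ℝ) + 1) (by linarith [k.cast_nonneg (α := ℝ)]))
    rw [lintegral_eq_zero_iff hF] at this
    exact (ae_restrict_iff' (measurableSet_parabolicCylinder n _)).1 this
  filter_upwards [ae_all_iff.2 h] with z hz
  obtain ⟨k, hk⟩ := exists_nat_gt (max ‖z.1‖ |z.2|)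
  have h1 := (le_max_left _ _).trans_lt hk
  have h2 := (le_max_right _ _).trans_lt hk
  refine hz k ⟨by simpa using h1.trans (by linarith), abs_lt.1 (h2.trans ?_) |>.imp ?_ id⟩
  · nlinarith [k.cast_nonneg (α := ℝ)]
  · intro h
    simpa using h

/-! ### Nonexistence for exponents below one -/

/-- Sublinear growth: a nontrivial source dominating a power `lam < 1` of its potential is bounded
below on a whole strip. -/
theorem exists_strip_lower_bound (n : ℕ) {α lam c : ℝ} (hα : 0 < α) (hlam : 0 < lam)
    (hlam1 : lam < 1) (hc : 0 < c) {F : SpaceTime n → ENNReal} (hF : Measurable F)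
    (hle : ∀ᵐ z, ENNReal.ofReal c * heatPot n α F z ^ lam ≤ F z) (hne : ¬ ∀ᵐ z, F z = 0) :
    ∃ m a b : ℝ, 0 < m ∧ a < b ∧
      ∀ᵐ z : SpaceTime n, z.2 ∈ Set.Ioo a b → ENNReal.ofReal m ≤ F z := by
  obtain ⟨R, hR1, hmass⟩ := exists_mass_pos n hF hne
  obtain ⟨κ, hκ, hgrow⟩ := exists_le_heatPot_of_le n hα
  have hR : 0 < R := by linarith
  set a := 2 * R ^ 2 with ha
  -- The growth rate of the solution of `v = J (v ^ lam)` that depends on time alone: `β = α + β *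
  -- lam`.
  set β := α / (1 - lam) with hβ
  have hl : 0 < 1 - lam := by linarith
  have hβ0 : 0 < β := by positivity
  have hβe : α + β * lam = β := by
    rw [hβ]
    field_simp
    ring
  set κ' := κ * c * (1 / 2) ^ β with hκ'
  have hκ'0 : 0 < κ' := by positivity
  -- The positive fixed point of the improvement map `K ↦ κ' * K ^ lam`.
  set L := κ' ^ (1 / (1 - lam)) with hL
  have hL0 : 0 < L := by positivity
  have hLfix : κ' * L ^ lam = L := by
    rw [hL, ← Real.rpow_mul hκ'0.le]
    nth_rewrite 1 [← Real.rpow_one κ']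
    rw [← Real.rpow_add hκ'0]
    congr 1
    field_simp
    ring
  have hU : ∀ x₀ : EuclideanSpace ℝ (Fin n), ∀ t ∈ Set.Ioo a (a + 1),
      ENNReal.ofReal (L / 2 * (t - a) ^ β) ≤ heatPot n α F (x₀, t) := by
    intro x₀
    have hstep : ∀ K : ℝ, 0 ≤ K → (∀ x ∈ Metric.ball x₀ 1, ∀ t ∈ Set.Ioo a (a + 1),
        ENNReal.ofReal (K * (t - a) ^ β) ≤ heatPot n α F (x, t)) →
        ∀ x ∈ Metric.ball x₀ 1, ∀ t ∈ Set.Ioo a (a + 1),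
        ENNReal.ofReal (κ' * K ^ lam * (t - a) ^ β) ≤ heatPot n α F (x, t) := by
      intro K hK hP x hx t ht
      have hta : 0 < t - a := by linarith [ht.1]
      set δ := (t - a) / 2 with hδ
      have hδ0 : 0 < δ := by positivity
      have := hgrow F x₀ 1 δ t (ENNReal.ofReal (c * (K * δ ^ β) ^ lam)) one_pos hδ0
        (by linarith [ht.2]) x hx (by
          filter_upwards [hle] with y hy hy1 hy2
          refine le_trans ?_ hy
          have hy2' : y.2 ∈ Set.Ioo a (a + 1) :=
            ⟨by linarith [hy2.1], by linarith [hy2.2, ht.2]⟩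
          have h1 := hP y.1 hy1 y.2 hy2'
          rw [ENNReal.ofReal_mul hc.le, ← ENNReal.ofReal_rpow_of_nonneg (by positivity) hlam.le]
          refine mul_le_mul_right (ENNReal.rpow_le_rpow (le_trans ?_ h1) hlam.le) _
          refine ENNReal.ofReal_le_ofReal ?_
          have : δ ≤ y.2 - a := by linarith [hy2.1]
          gcongr)
      refine le_trans (le_of_eq ?_) this
      rw [← ENNReal.ofReal_mul (by positivity)]
      congr 1
      have e1 : (t - a) ^ β * (1 / 2) ^ β = δ ^ β := by
        rw [← Real.mul_rpow hta.le (by norm_num), hδ]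
        congr 1
        ring
      rw [Real.mul_rpow hK (by positivity), ← Real.rpow_mul hδ0.le]
      have e2 : δ ^ α * δ ^ (β * lam) = δ ^ β := by rw [← Real.rpow_add hδ0, hβe]
      calc κ' * K ^ lam * (t - a) ^ β = κ * c * K ^ lam * ((t - a) ^ β * (1 / 2) ^ β) := by
            rw [hκ']
            ring
        _ = κ * c * K ^ lam * (δ ^ α * δ ^ (β * lam)) := by rw [e1, e2]
        _ = _ := by ring
    -- The starting bound `K₀` may degenerate as `x₀` goes to infinity; the iteration removes this
    -- dependence.
    obtain ⟨κ₁, hκ₁, hm⟩ := exists_mass_le_heatPot n hα (B := ‖x₀‖ + 1) (by positivity)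
    obtain ⟨K₀, hK₀, hK₀le⟩ : ∃ K₀ : ℝ, 0 < K₀ ∧ ENNReal.ofReal K₀ ≤
        ENNReal.ofReal (κ₁ * R ^ (2 * (α - 1 - (n : ℝ) / 2)))
          * ∫⁻ y in parabolicCylinder n R, F y := by
      have hpos : 0 < ENNReal.ofReal (κ₁ * R ^ (2 * (α - 1 - (n : ℝ) / 2)))
          * ∫⁻ y in parabolicCylinder n R, F y :=
        ENNReal.mul_pos (ENNReal.ofReal_pos.2 (by positivity)).ne' hmass.ne'
      obtain ⟨q, hq0, hq⟩ := ENNReal.lt_iff_exists_nnreal_btwn.1 hpos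
      exact ⟨q, by simpa using hq0, by simpa using hq.le⟩
    have hbase : ∀ x ∈ Metric.ball x₀ 1, ∀ t ∈ Set.Ioo a (a + 1),
        ENNReal.ofReal (K₀ * (t - a) ^ β) ≤ heatPot n α F (x, t) := by
      intro x hx t ht
      have hxx : ‖x‖ ≤ (‖x₀‖ + 1) * R := by
        have h1 : ‖x - x₀‖ < 1 := by simpa [dist_eq_norm] using hx
        have h2 : ‖x‖ ≤ ‖x - x₀‖ + ‖x₀‖ := by simpa using norm_add_le (x - x₀) x₀
        nlinarith [norm_nonneg x₀]
      refine le_trans (ENNReal.ofReal_le_ofReal ?_) (hK₀le.trans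
        (hm F R hR x t hxx ht.1.le (by nlinarith [ht.2])))
      exact mul_le_of_le_one_right hK₀.le
        (Real.rpow_le_one (by linarith [ht.1]) (by linarith [ht.2]) hβ0.le)
    -- Each improvement raises the ratio `K / L` to the power `lam`; since `lam ^ j → 0`, the
    -- constant tends to `L` from any positive start.
    have hiter : ∀ j : ℕ, ∀ x ∈ Metric.ball x₀ 1, ∀ t ∈ Set.Ioo a (a + 1),
        ENNReal.ofReal (L * (K₀ / L) ^ (lam ^ j) * (t - a) ^ β) ≤ heatPot n α F (x, t) := by
      intro j
      induction j with
      | zero =>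
        rw [pow_zero, Real.rpow_one, mul_div_cancel₀ _ hL0.ne']
        exact hbase
      | succ j ih =>
        have := hstep _ (by positivity) ih
        rwa [Real.mul_rpow hL0.le (by positivity), ← mul_assoc κ', hLfix,
          ← Real.rpow_mul (by positivity), ← pow_succ] at this
    have hlim : Filter.Tendsto (fun j : ℕ => L * (K₀ / L) ^ (lam ^ j)) Filter.atTop (nhds L) := by
      have h1 := tendsto_pow_atTop_nhds_zero_of_lt_one hlam.le hlam1
      have h2 := ((Real.continuous_const_rpow (a := K₀ / L) (by positivity)).tendsto 0).comp h1
      simpa using h2.const_mul L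
    obtain ⟨j, hj⟩ := (hlim.eventually_const_lt (half_lt_self hL0)).exists
    intro t ht
    refine le_trans (ENNReal.ofReal_le_ofReal ?_) (hiter j x₀ (by simp) t ht)
    have : 0 ≤ (t - a) ^ β := Real.rpow_nonneg (by linarith [ht.1]) β
    gcongr
  refine ⟨c * (L / 2 * (1 / 2) ^ β) ^ lam, a + 1 / 2, a + 1, by positivity, by linarith, ?_⟩
  filter_upwards [hle] with z hz ht
  refine le_trans ?_ hz
  rw [ENNReal.ofReal_mul hc.le, ← ENNReal.ofReal_rpow_of_nonneg (by positivity) hlam.le]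
  refine mul_le_mul_right (ENNReal.rpow_le_rpow (le_trans (ENNReal.ofReal_le_ofReal ?_)
    (hU z.1 z.2 ⟨by linarith [ht.1], ht.2⟩)) hlam.le) _
  have : 1 / 2 ≤ z.2 - a := by linarith [ht.1]
  gcongr

/-! ### Blow-up and the critical case for integrable sources -/

/-- Superlinear blow-up: a source dominating a power `lam > 1` of its potential cannot have
a potential that is large on a parabolic cylinder. -/
theorem exists_blowup_threshold (n : ℕ) {α lam c : ℝ} (hα : 0 < α) (hlam : 1 < lam) (hc : 0 < c) :
    ∃ Θ : ℝ, 0 < Θ ∧ ∀ (F : SpaceTime n → ENNReal) (x₀ : EuclideanSpace ℝ (Fin n)) (R a A : ℝ),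
      0 < R → 0 < A → (∀ᵐ z, ENNReal.ofReal c * heatPot n α F z ^ lam ≤ F z) →
      (∀ x ∈ Metric.ball x₀ R, ∀ t ∈ Set.Ioo a (a + R ^ 2),
        ENNReal.ofReal A ≤ heatPot n α F (x, t)) →
      (∀ᵐ z, F z ≠ ⊤) → A ^ (lam - 1) * R ^ (2 * α) < Θ := by
  obtain ⟨κ, hκ, hgrow⟩ := exists_le_heatPot_of_le n hα
  have hl : 0 < lam - 1 := by linarith
  have hl0 : 0 < lam := by linarith
  -- Halving `δ` costs `2 ^ (-α)` per step, and growth by `μ` gains `μ ^ (lam - 1) = 2 ^ α` in the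
  -- superlinear factor, so the two balance. The threshold below is what makes each step multiply
  -- the bound by `μ`.
  set μ : ℝ := 2 ^ (α / (lam - 1)) with hμ
  have hμ0 : 0 < μ := by positivity
  have hμ1 : 1 < μ := Real.one_lt_rpow one_lt_two (by positivity)
  have hμl : μ ^ (lam - 1) = 2 ^ α := by
    rw [hμ, ← Real.rpow_mul two_pos.le, div_mul_cancel₀ _ hl.ne']
  refine ⟨μ * 4 ^ α / (κ * c), by positivity, ?_⟩
  intro F x₀ R a A hR hA hle hU hfin
  by_contra! hΘ
  rw [div_le_iff₀ (by positivity)] at hΘ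
  have hR2 : 0 < R ^ 2 := by positivity
  -- The time losses form a geometric series of total `R ^ 2 / 2`, so the upper half of the cylinder
  -- survives all steps.
  have hiter : ∀ j : ℕ, ∀ x ∈ Metric.ball x₀ R,
      ∀ t ∈ Set.Ioo (a + R ^ 2 / 2 * (1 - (1 / 2) ^ j)) (a + R ^ 2),
      ENNReal.ofReal (A * μ ^ j) ≤ heatPot n α F (x, t) := by
    intro j
    induction j with
    | zero => simpa using hU
    | succ j ih =>
      intro x hx t ht
      set δ := R ^ 2 / 4 * (1 / 2) ^ j with hδ
      have hδ0 : 0 < δ := by positivity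
      have hpow : ((1 : ℝ) / 2) ^ j ≤ 1 := pow_le_one₀ (by norm_num) (by norm_num)
      have := hgrow F x₀ R δ t (ENNReal.ofReal (c * (A * μ ^ j) ^ lam)) hR hδ0
        (by nlinarith) x hx (by
          filter_upwards [hle] with y hy hy1 hy2
          refine le_trans ?_ hy
          have h1 := ih y.1 hy1 y.2 (by
            refine ⟨?_, hy2.2.trans ht.2⟩
            have h3 := ht.1
            have h4 := hy2.1
            rw [pow_succ (1 / 2 : ℝ)] at h3
            rw [hδ] at h4
            linarith)
          rw [ENNReal.ofReal_mul hc.le, ← ENNReal.ofReal_rpow_of_nonneg (by positivity) hl0.le]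
          exact mul_le_mul_right (ENNReal.rpow_le_rpow h1 hl0.le) _)
      refine le_trans ?_ this
      rw [← ENNReal.ofReal_mul (by positivity)]
      refine ENNReal.ofReal_le_ofReal ?_
      have e1 : (A * μ ^ j) ^ lam = A * μ ^ j * (A ^ (lam - 1) * (2 ^ α) ^ j) := by
        have : (A * μ ^ j) ^ lam = (A * μ ^ j) ^ (lam - 1) * (A * μ ^ j) := by
          rw [← Real.rpow_add_one (by positivity), sub_add_cancel]
        rw [this, Real.mul_rpow hA.le (by positivity), ← Real.rpow_natCast μ j,
          ← Real.rpow_mul hμ0.le, mul_comm (j : ℝ), Real.rpow_mul hμ0.le, hμl, Real.rpow_natCast,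
          Real.rpow_natCast]
        ring
      have e2 : δ ^ α * (2 ^ α) ^ j * 4 ^ α = R ^ (2 * α) := by
        have h2j : ((2 : ℝ) ^ α) ^ j = (2 ^ j) ^ α := by
          rw [← Real.rpow_natCast, ← Real.rpow_natCast, ← Real.rpow_mul two_pos.le,
            ← Real.rpow_mul two_pos.le, mul_comm]
        rw [h2j, ← Real.mul_rpow hδ0.le (by positivity), ← Real.mul_rpow (by positivity)
          (by norm_num), Real.rpow_mul hR.le, Real.rpow_two]
        congr 1
        have : ((1 : ℝ) / 2) ^ j * 2 ^ j = 1 := by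
          rw [← mul_pow]
          norm_num
        rw [hδ]
        linear_combination R ^ 2 * this
      have h4 : (0 : ℝ) < 4 ^ α := by positivity
      refine le_of_mul_le_mul_right ?_ h4
      calc A * μ ^ (j + 1) * 4 ^ α = A * μ ^ j * (μ * 4 ^ α) := by ring
        _ ≤ A * μ ^ j * (A ^ (lam - 1) * R ^ (2 * α) * (κ * c)) := by gcongr
        _ = _ := by
            rw [e1, ← e2]
            ring
  have htop : ∀ x ∈ Metric.ball x₀ R, ∀ t ∈ Set.Ioo (a + R ^ 2 / 2) (a + R ^ 2),
      heatPot n α F (x, t) = ⊤ := by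
    intro x hx t ht
    have hlim : Filter.Tendsto (fun j : ℕ => ENNReal.ofReal (A * μ ^ j)) Filter.atTop
        (nhds ⊤) :=
      ENNReal.tendsto_ofReal_atTop.comp
        ((tendsto_pow_atTop_atTop_of_one_lt hμ1).const_mul_atTop hA)
    refine top_le_iff.1 (le_of_tendsto' hlim fun j => hiter j x hx t ⟨?_, ht.2⟩)
    have : (0 : ℝ) < (1 / 2) ^ j := by positivity
    nlinarith [ht.1]
  have hnull : volume (Metric.ball x₀ R ×ˢ Set.Ioo (a + R ^ 2 / 2) (a + R ^ 2) :
      Set (SpaceTime n)) = 0 := by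
    refine measure_mono_null ?_ (ae_iff.1 (hfin.and hle))
    rintro z ⟨hz1, hz2⟩ ⟨h1, h2⟩
    rw [show z = (z.1, z.2) from rfl, htop z.1 hz1 z.2 hz2, ENNReal.top_rpow_of_pos hl0,
      ENNReal.mul_top (ENNReal.ofReal_pos.2 hc).ne'] at h2
    exact h1 (top_le_iff.1 h2)
  rw [volume_ball_prod_Ioo n x₀ hR, ENNReal.ofReal_eq_zero] at hnull
  have := unitBallVolume_pos n
  have h3 : 0 < R ^ n * unitBallVolume n * (a + R ^ 2 - (a + R ^ 2 / 2)) := by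
    refine mul_pos (by positivity) ?_
    linarith
  linarith

/-- Fujita's theorem at the critical exponent for the fractional heat potential. -/
theorem ae_eq_zero_of_heatPot_rpow_le_of_critical (n : ℕ) {α lam c : ℝ} (hα : 0 < α)
    (hlam : 1 < lam) (hc : 0 < c) (hcrit : α = ((n : ℝ) + 2) / 2 * (1 - 1 / lam))
    {F : SpaceTime n → ENNReal} (hF : Measurable F)
    (hle : ∀ᵐ z, ENNReal.ofReal c * heatPot n α F z ^ lam ≤ F z) (hfin : ∀ᵐ z, F z ≠ ⊤) :
    ∀ᵐ z, F z = 0 := by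
  by_contra hne
  obtain ⟨R₀, hR₀1, hmass⟩ := exists_mass_pos n hF hne
  obtain ⟨Θ, hΘ, hblow⟩ := exists_blowup_threshold n hα hlam hc
  obtain ⟨κ, hκ, hm⟩ := exists_mass_le_heatPot n hα (B := 2) (by norm_num)
  have hl0 : 0 < lam := by linarith
  have hl : 0 < lam - 1 := by linarith
  have hV := unitBallVolume_pos n
  set e := 2 * (α - 1 - (n : ℝ) / 2) with he
  -- Criticality: `(R ^ e) ^ lam` exactly cancels the volume `R ^ (n + 2)` of a parabolic cylinder.
  have hel : e * lam = -((n : ℝ) + 2) := by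
    rw [he, hcrit]
    field_simp
    ring
  -- Mass `m` in the cylinder makes the potential at least `κ * R ^ e * m` on a later one; at the
  -- critical exponent the blow-up threshold is then a bound on `m` free of `R`.
  have hbdd : ∀ R : ℝ, 0 < R →
      ∫⁻ y in parabolicCylinder n R, F y ≤ ENNReal.ofReal (Θ ^ (1 / (lam - 1)) / κ) := by
    intro R hR
    by_contra! hlt
    set m := Θ ^ (1 / (lam - 1)) / κ with hmdef
    have hm0 : 0 < m := by positivity
    have h1 := hblow F 0 R (2 * R ^ 2) (κ * R ^ e * m) hR (by positivity) hle (by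
      intro x hx t ht
      have hx' : ‖x‖ < R := by simpa using hx
      refine le_trans ?_ (hm F R hR x t (by linarith) ht.1.le
        (by linarith [ht.2, sq_nonneg R]))
      rw [ENNReal.ofReal_mul (by positivity)]
      gcongr) hfin
    have h2 : κ * R ^ e * m = Θ ^ (1 / (lam - 1)) * R ^ e := by
      rw [hmdef]
      field_simp
    rw [h2, Real.mul_rpow (by positivity) (by positivity), ← Real.rpow_mul hΘ.le,
      one_div_mul_cancel hl.ne', Real.rpow_one, mul_assoc, ← Real.rpow_mul hR.le,
      ← Real.rpow_add hR] at h1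
    have h3 : e * (lam - 1) + 2 * α = 0 := by linear_combination hel - he
    rw [h3, Real.rpow_zero, mul_one] at h1
    exact lt_irrefl _ h1
  -- The mass at scale `R` regenerates a definite amount of mass in a later cylinder, disjoint from
  -- the first and inside the doubled one.
  have hdouble : ∃ c' : ℝ, 0 < c' ∧ ∀ R : ℝ, 0 < R →
      ENNReal.ofReal c' * (∫⁻ y in parabolicCylinder n R, F y) ^ lam
        + ∫⁻ y in parabolicCylinder n R, F y ≤ ∫⁻ y in parabolicCylinder n (2 * R), F y := by
    refine ⟨c * κ ^ lam * (2 ^ n * unitBallVolume n * 2), by positivity, fun R hR => ?_⟩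
    set M := ∫⁻ y in parabolicCylinder n R, F y with hM
    set S : Set (SpaceTime n) := Metric.ball 0 (2 * R) ×ˢ Set.Ioo (2 * R ^ 2) (4 * R ^ 2) with hS
    have hSm : MeasurableSet S := Metric.isOpen_ball.measurableSet.prod measurableSet_Ioo
    have h1 := const_mul_measure_le_lintegral (μ := volume) hSm (g := F)
      (c := ENNReal.ofReal c * (ENNReal.ofReal (κ * R ^ e) * M) ^ lam) (by
        filter_upwards [hle] with y hy hyS
        refine le_trans (mul_le_mul_right (ENNReal.rpow_le_rpow ?_ hl0.le) _) hy
        have hx' : ‖y.1‖ < 2 * R := by simpa using hyS.1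
        exact hm F R hR y.1 y.2 hx'.le hyS.2.1.le hyS.2.2.le)
    have h2 : ENNReal.ofReal c * (ENNReal.ofReal (κ * R ^ e) * M) ^ lam * volume S
        = ENNReal.ofReal (c * κ ^ lam * (2 ^ n * unitBallVolume n * 2)) * M ^ lam := by
      rw [hS, volume_ball_prod_Ioo n 0 (by positivity), ENNReal.mul_rpow_of_nonneg _ _ hl0.le,
        ENNReal.ofReal_rpow_of_nonneg (by positivity) hl0.le, ← mul_assoc, mul_right_comm,
        ← ENNReal.ofReal_mul hc.le, ← ENNReal.ofReal_mul (by positivity)]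
      congr 2
      have hRn : R ^ (e * lam) * (R ^ n * R ^ 2) = 1 := by
        rw [hel, ← pow_add, ← Real.rpow_natCast, ← Real.rpow_add hR]
        push_cast
        rw [neg_add_cancel, Real.rpow_zero]
      rw [Real.mul_rpow hκ.le (by positivity), ← Real.rpow_mul hR.le, mul_pow]
      linear_combination (c * κ ^ lam * (2 ^ n * unitBallVolume n * 2)) * hRn
    rw [← h2]
    have hdisj : Disjoint S (parabolicCylinder n R) := by
      rw [Set.disjoint_left]
      rintro z ⟨_, hz⟩ ⟨_, hz'⟩
      have := hz.1
      have := hz'.2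
      nlinarith
    have hsub : S ∪ parabolicCylinder n R ⊆ parabolicCylinder n (2 * R) := by
      rintro z (⟨hz1, hz2⟩ | ⟨hz1, hz2⟩)
      · exact ⟨hz1, by nlinarith [hz2.1], by nlinarith [hz2.2]⟩
      · refine ⟨?_, by nlinarith [hz2.1], by nlinarith [hz2.2]⟩
        have hx' : ‖z.1‖ < R := by simpa using hz1
        simp only [Metric.mem_ball, dist_zero_right]
        linarith
    calc _ ≤ (∫⁻ y in S, F y) + M := add_le_add_left h1 _
      _ = ∫⁻ y in S ∪ parabolicCylinder n R, F y :=
          (lintegral_union (measurableSet_parabolicCylinder n R) hdisj).symm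
      _ ≤ _ := lintegral_mono_set hsub
  obtain ⟨c', hc', hdbl⟩ := hdouble
  set M₀ := ∫⁻ y in parabolicCylinder n R₀, F y with hM₀
  have hgrowth : ∀ k : ℕ, M₀ + k * (ENNReal.ofReal c' * M₀ ^ lam)
      ≤ ∫⁻ y in parabolicCylinder n (2 ^ k * R₀), F y := by
    intro k
    induction k with
    | zero => simp [hM₀]
    | succ k ih =>
      have h1 := hdbl (2 ^ k * R₀) (by positivity)
      have h2 : M₀ ≤ ∫⁻ y in parabolicCylinder n (2 ^ k * R₀), F y := le_self_add.trans ih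
      rw [show (2 : ℝ) ^ (k + 1) * R₀ = 2 * (2 ^ k * R₀) by ring]
      refine le_trans ?_ h1
      calc M₀ + ((k + 1 : ℕ) : ENNReal) * (ENNReal.ofReal c' * M₀ ^ lam)
          = ENNReal.ofReal c' * M₀ ^ lam + (M₀ + k * (ENNReal.ofReal c' * M₀ ^ lam)) := by
            push_cast
            ring
        _ ≤ _ := by gcongr
  have hε : ENNReal.ofReal c' * M₀ ^ lam ≠ 0 := by
    refine mul_ne_zero (ENNReal.ofReal_pos.2 hc').ne' ?_
    simp [ENNReal.rpow_eq_zero_iff, hmass.ne', hl0.not_gt]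
  obtain ⟨k, hk⟩ := ENNReal.exists_nat_mul_gt hε
    (ENNReal.ofReal_ne_top (r := Θ ^ (1 / (lam - 1)) / κ))
  exact absurd (hk.trans_le (le_add_self.trans (hgrowth k)))
    (hbdd _ (by positivity)).not_gt

/-! ### Parabolic scaling and the self-similar function -/

theorem lintegral_parabolic_scaling (n : ℕ) {t : ℝ} (ht : 0 < t) {g : SpaceTime n → ENNReal}
    (hg : Measurable g) :
    ∫⁻ y, g y = ENNReal.ofReal (t ^ ((n : ℝ) / 2 + 1))
      * ∫⁻ y : SpaceTime n, g (Real.sqrt t • y.1, t * y.2) := by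
  have hst : 0 < Real.sqrt t := Real.sqrt_pos.2 ht
  have hmap : Measure.map (Prod.map (fun x : EuclideanSpace ℝ (Fin n) => Real.sqrt t • x)
      (fun s : ℝ => t • s)) (volume : Measure (SpaceTime n))
      = ENNReal.ofReal (t ^ (-((n : ℝ) / 2 + 1))) • volume := by
    rw [Measure.volume_eq_prod, ← Measure.map_prod_map _ _ (by fun_prop) (by fun_prop),
      Measure.map_addHaar_smul _ hst.ne', Measure.map_addHaar_smul _ ht.ne',
      Measure.prod_smul_left, Measure.prod_smul_right, smul_smul,
      ← ENNReal.ofReal_mul (abs_nonneg _), finrank_euclideanSpace_fin, Module.finrank_self,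
      abs_of_pos (by positivity), abs_of_pos (by positivity)]
    congr 2
    rw [pow_one, Real.rpow_neg ht.le, Real.rpow_add_one ht.ne', mul_inv, Real.sqrt_eq_rpow,
      ← Real.rpow_natCast, ← Real.rpow_mul ht.le]
    congr 3
    ring
  have h := lintegral_map (μ := (volume : Measure (SpaceTime n))) hg
    (g := Prod.map (fun x : EuclideanSpace ℝ (Fin n) => Real.sqrt t • x)
      (fun s : ℝ => t • s)) (by fun_prop)
  rw [hmap, lintegral_smul_measure, smul_eq_mul] at h
  have h2 : ∫⁻ y : SpaceTime n, g (Real.sqrt t • y.1, t * y.2)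
      = ENNReal.ofReal (t ^ (-((n : ℝ) / 2 + 1))) * ∫⁻ y, g y := h.symm
  rw [h2, ← mul_assoc, ← ENNReal.ofReal_mul (by positivity), ← Real.rpow_add ht,
    add_neg_cancel, Real.rpow_zero, ENNReal.ofReal_one, one_mul]

theorem fracHeatKernel_scaling (n : ℕ) (α : ℝ) {t : ℝ} (ht : 0 < t)
    (x : EuclideanSpace ℝ (Fin n)) (s : ℝ) :
    fracHeatKernel n α (Real.sqrt t • x, t * s)
      = t ^ (α - 1 - (n : ℝ) / 2) * fracHeatKernel n α (x, s) := by
  rcases lt_or_ge 0 s with hs | hs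
  · have hts : 0 < t * s := by positivity
    rw [fracHeatKernel_of_pos n α _ hts, fracHeatKernel_of_pos n α _ hs]
    simp only [norm_smul, Real.norm_of_nonneg (Real.sqrt_nonneg t)]
    rw [Real.mul_rpow ht.le hs.le, mul_pow, Real.sq_sqrt ht.le,
      show -(t * ‖x‖ ^ 2) / (4 * (t * s)) = -‖x‖ ^ 2 / (4 * s) by field_simp]
    ring
  · rw [fracHeatKernel_of_nonpos n α (x, s) hs, mul_zero,
      fracHeatKernel_of_nonpos n α _ (mul_nonpos_of_nonneg_of_nonpos ht.le hs)]

/-- The kernel's degree `α - 1 - n/2` and the Jacobian's `n/2 + 1` add up to `α`, the gain in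
homogeneity. -/
theorem heatPot_scaling (n : ℕ) (α σ : ℝ) {t : ℝ} (ht : 0 < t) {F : SpaceTime n → ENNReal}
    (hF : Measurable F)
    (hs : ∀ y : SpaceTime n, F (Real.sqrt t • y.1, t * y.2) = ENNReal.ofReal (t ^ (-σ)) * F y)
    (x : EuclideanSpace ℝ (Fin n)) (s : ℝ) :
    heatPot n α F (Real.sqrt t • x, t * s)
      = ENNReal.ofReal (t ^ (α - σ)) * heatPot n α F (x, s) := by
  have hK : Measurable fun y : SpaceTime n =>
      ENNReal.ofReal (fracHeatKernel n α ((Real.sqrt t • x, t * s) - y)) * F y :=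
    (((measurable_fracHeatKernel n α).comp (measurable_const.sub measurable_id)).ennreal_ofReal).mul
      hF
  rw [heatPot, lintegral_parabolic_scaling n ht hK, heatPot,
    ← lintegral_const_mul' _ _ ENNReal.ofReal_ne_top,
    ← lintegral_const_mul' _ _ ENNReal.ofReal_ne_top]
  refine lintegral_congr fun y => ?_
  have h1 : ((Real.sqrt t • x, t * s) : SpaceTime n) - (Real.sqrt t • y.1, t * y.2)
      = (Real.sqrt t • (x - y.1), t * (s - y.2)) := by
    rw [Prod.mk_sub_mk, smul_sub, mul_sub]
  rw [h1, fracHeatKernel_scaling n α ht, hs, ENNReal.ofReal_mul (by positivity),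
    show α - σ = ((n : ℝ) / 2 + 1) + ((α - 1 - (n : ℝ) / 2) + -σ) by ring,
    Real.rpow_add ht ((n : ℝ) / 2 + 1), Real.rpow_add ht (α - 1 - (n : ℝ) / 2),
    ENNReal.ofReal_mul (by positivity), ENNReal.ofReal_mul (by positivity)]
  have : ((x, s) : SpaceTime n) - y = (x - y.1, s - y.2) := rfl
  rw [this]
  ring

theorem measurable_selfSimilar (n : ℕ) (lam α : ℝ) : Measurable (selfSimilar n lam α) := by
  unfold selfSimilar selfSimilarProfile
  refine Measurable.ite (measurableSet_lt measurable_const measurable_snd) ?_ measurable_const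
  fun_prop

theorem selfSimilarProfile_pos (n : ℕ) (lam α : ℝ) (z : EuclideanSpace ℝ (Fin n)) :
    0 < selfSimilarProfile n lam α z := by
  unfold selfSimilarProfile
  positivity

theorem selfSimilar_pos (n : ℕ) (lam α : ℝ) {z : SpaceTime n} (hz : 0 < z.2) :
    0 < selfSimilar n lam α z := by
  have := selfSimilarProfile_pos n lam α ((Real.sqrt z.2)⁻¹ • z.1)
  rw [selfSimilar, if_pos hz]
  positivity

theorem selfSimilar_of_nonpos (n : ℕ) (lam α : ℝ) {z : SpaceTime n} (hz : z.2 ≤ 0) :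
    selfSimilar n lam α z = 0 := by
  rw [selfSimilar, if_neg hz.not_gt]

theorem selfSimilar_nonneg (n : ℕ) (lam α : ℝ) (z : SpaceTime n) :
    0 ≤ selfSimilar n lam α z := by
  rcases lt_or_ge 0 z.2 with h | h
  · exact (selfSimilar_pos n lam α h).le
  · exact (selfSimilar_of_nonpos n lam α h).ge

theorem selfSimilar_rpow_of_pos (n : ℕ) {lam : ℝ} (hlam : 1 < lam) (α : ℝ) {z : SpaceTime n}
    (hz : 0 < z.2) :
    selfSimilar n lam α z ^ lam = z.2 ^ (-(α * lam / (lam - 1)))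
      * Real.exp (-(lam / (4 * z.2) * ‖z.1‖ ^ 2))
      * (‖z.1‖ ^ 2 / z.2 + 1) ^ (-(lam * (((n : ℝ) + 2) / 2 - α * lam / (lam - 1)))) := by
  have hw := selfSimilarProfile_pos n lam α ((Real.sqrt z.2)⁻¹ • z.1)
  have hl : lam - 1 ≠ 0 := by linarith
  rw [selfSimilar, if_pos hz, Real.mul_rpow (by positivity) hw.le, ← Real.rpow_mul hz.le,
    selfSimilarProfile, Real.mul_rpow (by positivity) (by positivity), ← Real.exp_mul,
    ← Real.rpow_mul (by positivity), norm_smul, mul_pow, norm_inv,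
    Real.norm_of_nonneg (Real.sqrt_nonneg _), inv_pow, Real.sq_sqrt hz.le, ← mul_assoc]
  congr 1
  · congr 2
    · field_simp
    · field_simp
  · congr 1
    · ring
    · ring

theorem selfSimilar_rpow_scaling (n : ℕ) {lam : ℝ} (hlam : 1 < lam) (α : ℝ) {t : ℝ} (ht : 0 < t)
    (y : SpaceTime n) :
    selfSimilar n lam α (Real.sqrt t • y.1, t * y.2) ^ lam
      = t ^ (-(α * lam / (lam - 1))) * selfSimilar n lam α y ^ lam := by
  have hl0 : lam ≠ 0 := by linarith
  rcases lt_or_ge 0 y.2 with hy | hy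
  · have hty : 0 < t * y.2 := by positivity
    rw [selfSimilar_rpow_of_pos n hlam α hy, selfSimilar_rpow_of_pos n hlam α (by exact hty)]
    simp only [norm_smul, mul_pow, Real.norm_of_nonneg (Real.sqrt_nonneg t), Real.sq_sqrt ht.le]
    rw [Real.mul_rpow ht.le hy.le,
      show lam / (4 * (t * y.2)) * (t * ‖y.1‖ ^ 2) = lam / (4 * y.2) * ‖y.1‖ ^ 2 by field_simp,
      show t * ‖y.1‖ ^ 2 / (t * y.2) = ‖y.1‖ ^ 2 / y.2 by field_simp]
    ring
  · rw [selfSimilar_of_nonpos n lam α hy, selfSimilar_of_nonpos n lam α (z := (_, t * y.2))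
      (mul_nonpos_of_nonneg_of_nonpos ht.le hy), Real.zero_rpow hl0, mul_zero]

/-! ### Two-sided bounds at unit time -/

theorem rpow_le_mul_exp {m c x : ℝ} (hm : 0 < m) (hc : 0 < c) (hx : 0 ≤ x) :
    x ^ m ≤ (m / c) ^ m * Real.exp (c * x) := by
  have h1 : x ≤ m / c * Real.exp (c * x / m) := by
    have := Real.add_one_le_exp (c * x / m)
    calc x = m / c * (c * x / m) := by field_simp
      _ ≤ _ := by
        gcongr
        linarith
  calc x ^ m ≤ (m / c * Real.exp (c * x / m)) ^ m := by gcongr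
    _ = _ := by
      rw [Real.mul_rpow (by positivity) (by positivity), ← Real.exp_mul]
      congr 2
      field_simp

theorem rpow_le_two {x e : ℝ} (h1 : 1 / 2 ≤ x) (h2 : x ≤ 1) (he : -1 < e) : x ^ e ≤ 2 := by
  have hx : 0 < x := by linarith
  calc x ^ e ≤ x ^ (-1 : ℝ) := Real.rpow_le_rpow_of_exponent_ge hx h2 he.le
    _ = x⁻¹ := Real.rpow_neg_one x
    _ ≤ (1 / 2)⁻¹ := by gcongr
    _ = 2 := by norm_num

/-- For `τ ≤ 1/2` a Gamma integral gives the power `-m`; for `τ ≥ 1/2` the exponential is at most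
`exp(-κ y / 2)`, which beats any power. Replacing `y` by `y + 1` in the exponent costs `exp κ` and
makes the bound uniform down to `y = 0`. -/
theorem exists_lintegral_beta_exp_le {α m κ : ℝ} (hα : 0 < α) (hm : 0 < m) (hκ : 0 < κ) :
    ∃ C : ℝ, 0 < C ∧ ∀ y : ℝ, 0 ≤ y →
      ∫⁻ τ in Set.Ioo (0 : ℝ) 1,
        ENNReal.ofReal ((1 - τ) ^ (α - 1) * τ ^ (m - 1) * Real.exp (-(κ * τ * y)))
        ≤ ENNReal.ofReal (C * (y + 1) ^ (-m)) := by
  have hΓ := Real.Gamma_pos_of_pos hm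
  set D := (m / (κ / 2)) ^ m * Real.exp (κ / 2) with hD
  have hD0 : 0 < D := by positivity
  refine ⟨2 * Real.exp κ * ((1 / κ) ^ m * Real.Gamma m) + 2 * D * (1 / α), by positivity, ?_⟩
  intro y hy
  have hy1 : 0 < y + 1 := by linarith
  have hexp : Real.exp (-(κ / 2 * y)) ≤ D * (y + 1) ^ (-m) := by
    have := rpow_le_mul_exp hm (c := κ / 2) (by positivity) hy1.le
    rw [Real.rpow_neg hy1.le, ← div_eq_mul_inv, le_div_iff₀ (by positivity)]
    calc Real.exp (-(κ / 2 * y)) * (y + 1) ^ m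
        ≤ Real.exp (-(κ / 2 * y)) * ((m / (κ / 2)) ^ m * Real.exp (κ / 2 * (y + 1))) := by gcongr
      _ = (m / (κ / 2)) ^ m * (Real.exp (-(κ / 2 * y)) * Real.exp (κ / 2 * (y + 1))) := by ring
      _ = D := by
        rw [← Real.exp_add, hD]
        congr 2
        ring
  have hpt : ∀ τ ∈ Set.Ioo (0 : ℝ) 1,
      ENNReal.ofReal ((1 - τ) ^ (α - 1) * τ ^ (m - 1) * Real.exp (-(κ * τ * y)))
      ≤ ENNReal.ofReal (2 * Real.exp κ)
          * ENNReal.ofReal (τ ^ (m - 1) * Real.exp (-(κ * (y + 1) * τ)))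
        + ENNReal.ofReal (2 * (D * (y + 1) ^ (-m))) * ENNReal.ofReal ((1 - τ) ^ (α - 1)) := by
    intro τ hτ
    have hτ0 := hτ.1
    have hτ1 : 0 < 1 - τ := by linarith [hτ.2]
    rw [← ENNReal.ofReal_mul (by positivity), ← ENNReal.ofReal_mul (by positivity),
      ← ENNReal.ofReal_add (by positivity) (by positivity)]
    refine ENNReal.ofReal_le_ofReal ?_
    rcases le_total τ (1 / 2) with h | h
    · have h1 : (1 - τ) ^ (α - 1) ≤ 2 := rpow_le_two (by linarith) (by linarith) (by linarith)
      have h2 : Real.exp (-(κ * τ * y)) ≤ Real.exp κ * Real.exp (-(κ * (y + 1) * τ)) := by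
        rw [← Real.exp_add]
        refine Real.exp_le_exp.2 ?_
        nlinarith
      calc (1 - τ) ^ (α - 1) * τ ^ (m - 1) * Real.exp (-(κ * τ * y))
          ≤ 2 * τ ^ (m - 1) * (Real.exp κ * Real.exp (-(κ * (y + 1) * τ))) := by gcongr
        _ = 2 * Real.exp κ * (τ ^ (m - 1) * Real.exp (-(κ * (y + 1) * τ))) := by ring
        _ ≤ _ := le_add_of_nonneg_right (by positivity)
    · have h1 : τ ^ (m - 1) ≤ 2 := rpow_le_two h hτ.2.le (by linarith)
      have h2 : Real.exp (-(κ * τ * y)) ≤ D * (y + 1) ^ (-m) := by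
        refine le_trans (Real.exp_le_exp.2 (neg_le_neg ?_)) hexp
        have : κ / 2 ≤ κ * τ := by nlinarith
        gcongr
      calc (1 - τ) ^ (α - 1) * τ ^ (m - 1) * Real.exp (-(κ * τ * y))
          ≤ (1 - τ) ^ (α - 1) * 2 * (D * (y + 1) ^ (-m)) := by gcongr
        _ = 2 * (D * (y + 1) ^ (-m)) * (1 - τ) ^ (α - 1) := by ring
        _ ≤ _ := le_add_of_nonneg_left (by positivity)
  have hI1 : ∫⁻ τ in Set.Ioo (0 : ℝ) 1,
      ENNReal.ofReal (τ ^ (m - 1) * Real.exp (-(κ * (y + 1) * τ)))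
      ≤ ENNReal.ofReal ((1 / κ) ^ m * Real.Gamma m * (y + 1) ^ (-m)) := by
    have hr : 0 < κ * (y + 1) := by positivity
    have h := Real.integral_rpow_mul_exp_neg_mul_Ioi hm hr
    have hpos : 0 < (1 / (κ * (y + 1))) ^ m * Real.Gamma m := by positivity
    have hint : IntegrableOn (fun t : ℝ => t ^ (m - 1) * Real.exp (-(κ * (y + 1) * t)))
        (Set.Ioi 0) := by
      by_contra hc
      rw [integral_undef hc] at h
      linarith
    refine (lintegral_mono_set Set.Ioo_subset_Ioi_self).trans (le_of_eq ?_)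
    rw [← ofReal_integral_eq_lintegral_ofReal hint ((ae_restrict_iff' measurableSet_Ioi).2
      (Filter.Eventually.of_forall fun t (ht : 0 < t) => by positivity)), h]
    congr 1
    rw [← one_div_mul_one_div, Real.mul_rpow (by positivity) (by positivity),
      Real.rpow_neg hy1.le, one_div (y + 1), Real.inv_rpow hy1.le]
    ring
  have hI2 : ∫⁻ τ in Set.Ioo (0 : ℝ) 1, ENNReal.ofReal ((1 - τ) ^ (α - 1))
      = ENNReal.ofReal (1 / α) := by
    have h := lintegral_rpow_Ioo (e := α - 1) (T := 1) (by linarith) zero_le_one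
    rw [sub_add_cancel, Real.one_rpow] at h
    rw [← h, ← lintegral_indicator measurableSet_Ioo, ← lintegral_indicator measurableSet_Ioo,
      ← lintegral_sub_left_eq_self
        (fun t => (Set.Ioo (0 : ℝ) 1).indicator (fun t => ENNReal.ofReal (t ^ (α - 1))) t) 1]
    refine lintegral_congr fun t => ?_
    by_cases ht : t ∈ Set.Ioo (0 : ℝ) 1
    · rw [Set.indicator_of_mem ht, Set.indicator_of_mem
        (show 1 - t ∈ Set.Ioo (0 : ℝ) 1 from ⟨by linarith [ht.2], by linarith [ht.1]⟩)]
    · rw [Set.indicator_of_notMem ht, Set.indicator_of_notMem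
        (fun h' : 1 - t ∈ Set.Ioo (0 : ℝ) 1 => ht ⟨by linarith [h'.2], by linarith [h'.1]⟩)]
  calc _ ≤ ∫⁻ τ in Set.Ioo (0 : ℝ) 1, (ENNReal.ofReal (2 * Real.exp κ)
          * ENNReal.ofReal (τ ^ (m - 1) * Real.exp (-(κ * (y + 1) * τ)))
        + ENNReal.ofReal (2 * (D * (y + 1) ^ (-m))) * ENNReal.ofReal ((1 - τ) ^ (α - 1))) :=
        setLIntegral_mono' measurableSet_Ioo hpt
    _ = ENNReal.ofReal (2 * Real.exp κ) * (∫⁻ τ in Set.Ioo (0 : ℝ) 1,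
          ENNReal.ofReal (τ ^ (m - 1) * Real.exp (-(κ * (y + 1) * τ))))
        + ENNReal.ofReal (2 * (D * (y + 1) ^ (-m))) * ENNReal.ofReal (1 / α) := by
        rw [lintegral_add_left (by fun_prop), lintegral_const_mul' _ _ ENNReal.ofReal_ne_top,
          lintegral_const_mul' _ _ ENNReal.ofReal_ne_top, hI2]
    _ ≤ ENNReal.ofReal (2 * Real.exp κ)
          * ENNReal.ofReal ((1 / κ) ^ m * Real.Gamma m * (y + 1) ^ (-m))
        + ENNReal.ofReal (2 * (D * (y + 1) ^ (-m))) * ENNReal.ofReal (1 / α) := by gcongr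
    _ = _ := by
        rw [← ENNReal.ofReal_mul (by positivity), ← ENNReal.ofReal_mul (by positivity),
          ← ENNReal.ofReal_add (by positivity) (by positivity)]
        congr 1
        ring

/-- At unit time, the potential of `selfSimilar ^ lam` is bounded above by the profile. -/
theorem exists_heatPot_selfSimilar_le (n : ℕ) {lam α : ℝ} (hlam : 1 < lam) (hα : 0 < α)
    (hm : 0 < ((n : ℝ) + 2) / 2 - α * lam / (lam - 1)) :
    ∃ C : ℝ, 0 < C ∧ ∀ z : EuclideanSpace ℝ (Fin n),
      heatPot n α (fun y => ENNReal.ofReal (selfSimilar n lam α y ^ lam)) (z, 1)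
        ≤ ENNReal.ofReal (C * selfSimilarProfile n lam α z) := by
  have hl : 0 < lam - 1 := by linarith
  have hl0 : 0 < lam := by linarith
  set σ := α * lam / (lam - 1) with hσ
  set m := ((n : ℝ) + 2) / 2 - σ with hmd
  -- The slope at `τ = 0` of the convex function `lam / (4 * (τ + lam * (1 - τ)))`, the exponent of
  -- the convolved Gaussians, whose value there is `1/4`. The tangent line is a lower bound.
  set κ := (lam - 1) / (4 * lam) with hκ
  have hκ0 : 0 < κ := by positivity
  obtain ⟨C, hC, hbeta⟩ := exists_lintegral_beta_exp_le hα hm hκ0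
  have hc := fracHeatConst_pos n hα
  set c := fracHeatConst n α with hcd
  set N := c * (4 * Real.pi) ^ ((n : ℝ) / 2) with hN
  have hN0 : 0 < N := by positivity
  refine ⟨N * C, by positivity, fun z => ?_⟩
  set G : SpaceTime n → ENNReal := fun y =>
    ENNReal.ofReal (fracHeatKernel n α ((z, 1) - y)) *
      ENNReal.ofReal (selfSimilar n lam α y ^ lam) with hG
  have hGm : Measurable G :=
    ((measurable_fracHeatKernel n α).comp (measurable_const.sub measurable_id)).ennreal_ofReal.mul
      ((measurable_selfSimilar n lam α).pow_const lam).ennreal_ofReal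
  have hslice0 : ∀ τ : ℝ, τ ∉ Set.Ioo (0 : ℝ) 1 → ∀ ξ, G (ξ, τ) = 0 := by
    intro τ hτ ξ
    rcases le_or_gt τ 0 with h | h
    · simp only [hG]
      rw [selfSimilar_of_nonpos n lam α (z := (ξ, τ)) h, Real.zero_rpow hl0.ne',
        ENNReal.ofReal_zero, mul_zero]
    · have h1 : 1 ≤ τ := not_lt.1 fun h' => hτ ⟨h, h'⟩
      simp only [hG]
      rw [fracHeatKernel_of_nonpos n α _ (by simpa using h1), ENNReal.ofReal_zero, zero_mul]
  have hslice : ∀ τ ∈ Set.Ioo (0 : ℝ) 1, ∫⁻ ξ, G (ξ, τ)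
      ≤ ENNReal.ofReal (N * Real.exp (-‖z‖ ^ 2 / 4)) * ENNReal.ofReal
        ((1 - τ) ^ (α - 1) * τ ^ (m - 1) * Real.exp (-(κ * τ * ‖z‖ ^ 2))) := by
    intro τ hτ
    have hτ0 := hτ.1
    have hτ1 : 0 < 1 - τ := by linarith [hτ.2]
    set a := 1 / (4 * (1 - τ)) with ha
    set b := lam / (4 * τ) with hb
    have ha0 : 0 < a := by positivity
    have hb0 : 0 < b := by positivity
    have hpt : ∀ ξ, G (ξ, τ) ≤ ENNReal.ofReal (c * (1 - τ) ^ (α - 1 - (n : ℝ) / 2) * τ ^ (-σ))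
        * ENNReal.ofReal (Real.exp (-(a * ‖ξ - z‖ ^ 2 + b * ‖ξ‖ ^ 2))) := by
      intro ξ
      simp only [hG]
      rw [← ENNReal.ofReal_mul (fracHeatKernel_nonneg n hα _),
        ← ENNReal.ofReal_mul (by positivity), selfSimilar_rpow_of_pos n hlam α (z := (ξ, τ)) hτ0,
        fracHeatKernel_of_pos n α _ (by simpa using hτ1)]
      refine ENNReal.ofReal_le_ofReal ?_
      simp only [Prod.mk_sub_mk]
      -- The algebraic weight of the source is not needed: the decay in `z` comes from the time
      -- integral.
      have h1 : (‖ξ‖ ^ 2 / τ + 1) ^ (-(lam * m)) ≤ 1 :=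
        Real.rpow_le_one_of_one_le_of_nonpos (le_add_of_nonneg_left (by positivity))
          (by nlinarith)
      calc c * (1 - τ) ^ (α - 1 - (n : ℝ) / 2) * Real.exp (-‖z - ξ‖ ^ 2 / (4 * (1 - τ)))
            * (τ ^ (-σ) * Real.exp (-(b * ‖ξ‖ ^ 2)) * (‖ξ‖ ^ 2 / τ + 1) ^ (-(lam * m)))
          ≤ c * (1 - τ) ^ (α - 1 - (n : ℝ) / 2) * Real.exp (-‖z - ξ‖ ^ 2 / (4 * (1 - τ)))
            * (τ ^ (-σ) * Real.exp (-(b * ‖ξ‖ ^ 2)) * 1) := by gcongr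
        _ = c * (1 - τ) ^ (α - 1 - (n : ℝ) / 2) * τ ^ (-σ)
            * (Real.exp (-‖z - ξ‖ ^ 2 / (4 * (1 - τ))) * Real.exp (-(b * ‖ξ‖ ^ 2))) := by ring
        _ = _ := by
            rw [← Real.exp_add, norm_sub_rev z ξ, ha]
            congr 2
            ring
    have hden : 0 < τ + lam * (1 - τ) := by positivity
    have hab : a + b = (τ + lam * (1 - τ)) / (4 * τ * (1 - τ)) := by
      rw [ha, hb]
      field_simp
    have hexp : Real.exp (-(a * b / (a + b) * ‖z‖ ^ 2))
        ≤ Real.exp (-‖z‖ ^ 2 / 4) * Real.exp (-(κ * τ * ‖z‖ ^ 2)) := by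
      rw [← Real.exp_add]
      refine Real.exp_le_exp.2 ?_
      have h1 : 1 / 4 + κ * τ ≤ a * b / (a + b) := by
        have h2 : a * b / (a + b) = lam / (4 * (τ + lam * (1 - τ))) := by
          rw [hab, ha, hb]
          field_simp
        rw [h2, hκ, le_div_iff₀ (by positivity)]
        have h3 : (1 / 4 + (lam - 1) / (4 * lam) * τ) * (4 * (τ + lam * (1 - τ)))
            = lam - ((lam - 1) * τ) ^ 2 / lam := by
          field_simp
          ring
        rw [h3]
        have : 0 ≤ ((lam - 1) * τ) ^ 2 / lam := by positivity
        linarith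
      have h5 := mul_le_mul_of_nonneg_right h1 (sq_nonneg ‖z‖)
      linarith
    have hpi : (Real.pi / (a + b)) ^ ((n : ℝ) / 2)
        ≤ (4 * Real.pi) ^ ((n : ℝ) / 2) * (τ ^ ((n : ℝ) / 2) * (1 - τ) ^ ((n : ℝ) / 2)) := by
      rw [← Real.mul_rpow hτ0.le hτ1.le, ← Real.mul_rpow (by positivity) (by positivity)]
      refine Real.rpow_le_rpow (by positivity) ?_ (by positivity)
      rw [hab, div_div_eq_mul_div, div_le_iff₀ hden]
      have h1 : 1 ≤ τ + lam * (1 - τ) := by nlinarith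
      calc Real.pi * (4 * τ * (1 - τ)) = 4 * Real.pi * (τ * (1 - τ)) * 1 := by ring
        _ ≤ _ := by gcongr
    calc ∫⁻ ξ, G (ξ, τ) ≤ ∫⁻ ξ : EuclideanSpace ℝ (Fin n),
          ENNReal.ofReal (c * (1 - τ) ^ (α - 1 - (n : ℝ) / 2) * τ ^ (-σ))
            * ENNReal.ofReal (Real.exp (-(a * ‖ξ - z‖ ^ 2 + b * ‖ξ‖ ^ 2))) := lintegral_mono hpt
      _ = ENNReal.ofReal (c * (1 - τ) ^ (α - 1 - (n : ℝ) / 2) * τ ^ (-σ)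
            * (Real.exp (-(a * b / (a + b) * ‖z‖ ^ 2))
              * (Real.pi / (a + b)) ^ ((n : ℝ) / 2))) := by
          rw [lintegral_const_mul' _ _ ENNReal.ofReal_ne_top,
            lintegral_gaussian_mul_gaussian n ha0 hb0, ← ENNReal.ofReal_mul (by positivity)]
      _ ≤ ENNReal.ofReal (c * (1 - τ) ^ (α - 1 - (n : ℝ) / 2) * τ ^ (-σ)
            * (Real.exp (-‖z‖ ^ 2 / 4) * Real.exp (-(κ * τ * ‖z‖ ^ 2))
              * ((4 * Real.pi) ^ ((n : ℝ) / 2)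
                * (τ ^ ((n : ℝ) / 2) * (1 - τ) ^ ((n : ℝ) / 2))))) := by
          refine ENNReal.ofReal_le_ofReal ?_
          gcongr
      _ = _ := by
          rw [← ENNReal.ofReal_mul (by positivity)]
          congr 1
          have e1 : (1 - τ) ^ (α - 1)
              = (1 - τ) ^ (α - 1 - (n : ℝ) / 2) * (1 - τ) ^ ((n : ℝ) / 2) := by
            rw [← Real.rpow_add hτ1, sub_add_cancel]
          have e2 : τ ^ (m - 1) = τ ^ (-σ) * τ ^ ((n : ℝ) / 2) := by
            rw [← Real.rpow_add hτ0, hmd]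
            congr 1
            ring
          rw [e1, e2, hN]
          ring
  have hpot : heatPot n α (fun y => ENNReal.ofReal (selfSimilar n lam α y ^ lam)) (z, 1)
      = ∫⁻ τ : ℝ, ∫⁻ ξ, G (ξ, τ) := by
    rw [heatPot, Measure.volume_eq_prod]
    exact lintegral_prod_symm' G hGm
  rw [hpot]
  calc ∫⁻ τ : ℝ, ∫⁻ ξ, G (ξ, τ)
      = ∫⁻ τ in Set.Ioo (0 : ℝ) 1, ∫⁻ ξ, G (ξ, τ) := by
        rw [← lintegral_indicator measurableSet_Ioo]
        refine lintegral_congr fun τ => ?_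
        by_cases hτ : τ ∈ Set.Ioo (0 : ℝ) 1
        · rw [Set.indicator_of_mem hτ]
        · rw [Set.indicator_of_notMem hτ]
          simp [hslice0 τ hτ]
    _ ≤ ∫⁻ τ in Set.Ioo (0 : ℝ) 1, ENNReal.ofReal (N * Real.exp (-‖z‖ ^ 2 / 4)) * ENNReal.ofReal
        ((1 - τ) ^ (α - 1) * τ ^ (m - 1) * Real.exp (-(κ * τ * ‖z‖ ^ 2))) :=
        setLIntegral_mono' measurableSet_Ioo hslice
    _ ≤ ENNReal.ofReal (N * Real.exp (-‖z‖ ^ 2 / 4))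
        * ENNReal.ofReal (C * (‖z‖ ^ 2 + 1) ^ (-m)) := by
        rw [lintegral_const_mul' _ _ ENNReal.ofReal_ne_top]
        gcongr
        exact hbeta _ (sq_nonneg _)
    _ = _ := by
        rw [← ENNReal.ofReal_mul (by positivity), selfSimilarProfile]
        congr 1
        ring

/-- With `ρ * ‖z‖ ^ 2` bounded, the cross term `‖z‖ * ‖ξ‖` and the shift `τ * ‖z‖ ^ 2` are bounded
too, so the Gaussian loses only a constant factor against `exp(-‖z‖²/4)`. -/
theorem gaussian_exponent_le {n : ℕ} {lam ρ τ : ℝ} (hlam : 0 < lam)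
    {z ξ : EuclideanSpace ℝ (Fin n)} (hρ1 : ρ ≤ 1 / 2) (hρz : ρ * ‖z‖ ^ 2 ≤ 1 / 2)
    (hτ1 : ρ / 2 < τ) (hτ2 : τ < ρ) (hξ : ‖ξ‖ ^ 2 ≤ ρ) :
    ‖z - ξ‖ ^ 2 / (4 * (1 - τ)) + lam / (4 * τ) * ‖ξ‖ ^ 2 ≤ ‖z‖ ^ 2 / 4 + (2 + lam / 2) := by
  have hτ0 : 0 < τ := by linarith
  have h1τ : 0 < 1 - τ := by linarith
  have h5 : lam / (4 * τ) * ‖ξ‖ ^ 2 ≤ lam / 2 := by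
    have h : ‖ξ‖ ^ 2 ≤ 2 * τ := by linarith
    calc lam / (4 * τ) * ‖ξ‖ ^ 2 ≤ lam / (4 * τ) * (2 * τ) := by gcongr
      _ = lam / 2 := by
        field_simp
        norm_num
  have h9 : 2 * (‖z‖ * ‖ξ‖) ≤ 2 := by
    have h8 : (‖z‖ * ‖ξ‖) ^ 2 ≤ 1 ^ 2 := by
      rw [mul_pow]
      calc ‖z‖ ^ 2 * ‖ξ‖ ^ 2 ≤ ‖z‖ ^ 2 * ρ := by gcongr
        _ ≤ 1 ^ 2 := by linarith
    have := (sq_le_sq₀ (by positivity) zero_le_one).1 h8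
    linarith
  have h6 : ‖z - ξ‖ ^ 2 ≤ ‖z‖ ^ 2 + 3 := by
    calc ‖z - ξ‖ ^ 2 ≤ (‖z‖ + ‖ξ‖) ^ 2 := by
          gcongr
          exact norm_sub_le _ _
      _ = ‖z‖ ^ 2 + 2 * (‖z‖ * ‖ξ‖) + ‖ξ‖ ^ 2 := by ring
      _ ≤ ‖z‖ ^ 2 + 3 := by linarith
  have h10 : ‖z - ξ‖ ^ 2 / (4 * (1 - τ)) ≤ ‖z‖ ^ 2 / 4 + 2 := by
    rw [div_le_iff₀ (by positivity)]
    have h11 : τ * ‖z‖ ^ 2 ≤ ρ * ‖z‖ ^ 2 := by gcongr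
    have h12 : (‖z‖ ^ 2 / 4 + 2) * (4 * (1 - τ)) = ‖z‖ ^ 2 - τ * ‖z‖ ^ 2 + 8 * (1 - τ) := by ring
    linarith
  linarith

/-- At unit time, the potential of `selfSimilar ^ lam` is bounded below by the profile. -/
theorem exists_le_heatPot_selfSimilar (n : ℕ) {lam α : ℝ} (hlam : 1 < lam) (hα : 0 < α)
    (hm : 0 < ((n : ℝ) + 2) / 2 - α * lam / (lam - 1)) :
    ∃ C : ℝ, 0 < C ∧ ∀ z : EuclideanSpace ℝ (Fin n),
      ENNReal.ofReal (C * selfSimilarProfile n lam α z)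
        ≤ heatPot n α (fun y => ENNReal.ofReal (selfSimilar n lam α y ^ lam)) (z, 1) := by
  have hl : 0 < lam - 1 := by linarith
  have hl0 : 0 < lam := by linarith
  set σ := α * lam / (lam - 1) with hσ
  have hσ0 : 0 < σ := by positivity
  set m := ((n : ℝ) + 2) / 2 - σ with hmd
  have hc := fracHeatConst_pos n hα
  set c := fracHeatConst n α with hcd
  set e := α - 1 - (n : ℝ) / 2 with he
  have hV := unitBallVolume_pos n
  set N := c * (1 / 2) ^ |e| * Real.exp (-(2 + lam / 2)) * 3 ^ (-(lam * m)) with hN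
  have hN0 : 0 < N := by positivity
  refine ⟨N * (unitBallVolume n * (1 / 2)) * (1 / 2) ^ m, by positivity, fun z => ?_⟩
  set y := ‖z‖ ^ 2 with hy
  have hy0 : 0 ≤ y := sq_nonneg _
  -- The time scale that dominates the upper bound. A cylinder of this scale has volume of order `ρ
  -- ^ (n/2 + 1)` and the source there has size `ρ ^ (-σ)`; the product `ρ ^ m` is the algebraic
  -- factor of the profile.
  set ρ := 1 / (2 * (y + 1)) with hρ
  have hρ0 : 0 < ρ := by positivity
  have hρy : ρ * (y + 1) = 1 / 2 := by
    rw [hρ]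
    field_simp
  have hρ1 : ρ ≤ 1 / 2 := by nlinarith
  have hρy' : ρ * y ≤ 1 / 2 := by nlinarith
  set S : Set (SpaceTime n) := Metric.ball 0 (Real.sqrt ρ) ×ˢ Set.Ioo (ρ / 2) ρ with hS
  have hSm : MeasurableSet S := Metric.isOpen_ball.measurableSet.prod measurableSet_Ioo
  have key := const_mul_measure_le_lintegral (μ := volume) hSm
    (c := ENNReal.ofReal (N * Real.exp (-y / 4) * ρ ^ (-σ)))
    (g := fun w => ENNReal.ofReal (fracHeatKernel n α ((z, 1) - w))
      * ENNReal.ofReal (selfSimilar n lam α w ^ lam))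
    (Filter.Eventually.of_forall fun w hw => by
      obtain ⟨ξ, τ⟩ := w
      obtain ⟨hw1, hτ1, hτ2⟩ := hw
      simp only at hw1 hτ1 hτ2
      have hτ0 : 0 < τ := by linarith
      have h1τ : 0 < 1 - τ := by linarith
      have hξ : ‖ξ‖ < Real.sqrt ρ := by simpa using hw1
      have hξ2 : ‖ξ‖ ^ 2 ≤ ρ := by
        rw [← Real.sq_sqrt hρ0.le]
        gcongr
      rw [← ENNReal.ofReal_mul (fracHeatKernel_nonneg n hα _),
        selfSimilar_rpow_of_pos n hlam α (z := (ξ, τ)) hτ0,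
        fracHeatKernel_of_pos n α _ (by simpa using h1τ)]
      refine ENNReal.ofReal_le_ofReal ?_
      simp only [Prod.mk_sub_mk]
      have h1 : (1 / 2 : ℝ) ^ |e| ≤ (1 - τ) ^ e := by
        calc (1 / 2 : ℝ) ^ |e| ≤ (1 - τ) ^ |e| := by
              gcongr
              linarith
          _ ≤ (1 - τ) ^ e :=
              Real.rpow_le_rpow_of_exponent_ge h1τ (by linarith) (le_abs_self e)
      have h2 : ρ ^ (-σ) ≤ τ ^ (-σ) :=
        Real.rpow_le_rpow_of_nonpos hτ0 hτ2.le (by linarith)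
      have h3 : (3 : ℝ) ^ (-(lam * m)) ≤ (‖ξ‖ ^ 2 / τ + 1) ^ (-(lam * m)) := by
        refine Real.rpow_le_rpow_of_nonpos (by positivity) ?_ (by nlinarith)
        have : ‖ξ‖ ^ 2 / τ ≤ 2 := by
          rw [div_le_iff₀ hτ0]
          linarith
        linarith
      have h4 : Real.exp (-y / 4) * Real.exp (-(2 + lam / 2))
          ≤ Real.exp (-‖z - ξ‖ ^ 2 / (4 * (1 - τ))) * Real.exp (-(lam / (4 * τ) * ‖ξ‖ ^ 2)) := by
        rw [← Real.exp_add, ← Real.exp_add, neg_div, neg_div, ← neg_add, ← neg_add]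
        exact Real.exp_le_exp.2 (neg_le_neg (gaussian_exponent_le hl0 hρ1 hρy' hτ1 hτ2 hξ2))
      calc N * Real.exp (-y / 4) * ρ ^ (-σ)
          = c * (1 / 2) ^ |e| * (ρ ^ (-σ) * 3 ^ (-(lam * m)))
            * (Real.exp (-y / 4) * Real.exp (-(2 + lam / 2))) := by
            rw [hN]
            ring
        _ ≤ c * (1 - τ) ^ e * (τ ^ (-σ) * (‖ξ‖ ^ 2 / τ + 1) ^ (-(lam * m)))
            * (Real.exp (-‖z - ξ‖ ^ 2 / (4 * (1 - τ)))
              * Real.exp (-(lam / (4 * τ) * ‖ξ‖ ^ 2))) := by gcongr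
        _ = _ := by ring)
  refine le_trans (le_of_eq ?_) (key.trans (setLIntegral_le_lintegral _ _))
  rw [hS, volume_ball_prod_Ioo n 0 (Real.sqrt_pos.2 hρ0), ← ENNReal.ofReal_mul (by positivity),
    selfSimilarProfile]
  congr 1
  have e1 : ρ ^ (-σ) * (Real.sqrt ρ ^ n * ρ) = ρ ^ m := by
    rw [Real.sqrt_eq_rpow, ← Real.rpow_natCast, ← Real.rpow_mul hρ0.le, ← Real.rpow_add_one hρ0.ne',
      ← Real.rpow_add hρ0, hmd]
    congr 1
    ring
  have e2 : ρ ^ m = (1 / 2) ^ m * (y + 1) ^ (-m) := by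
    rw [hρ, ← one_div_mul_one_div, Real.mul_rpow (by norm_num) (by positivity),
      Real.rpow_neg (by positivity), one_div (y + 1), Real.inv_rpow (by positivity)]
  calc N * (unitBallVolume n * (1 / 2)) * (1 / 2) ^ m * (Real.exp (-y / 4) * (y + 1) ^ (-m))
      = N * (unitBallVolume n * (1 / 2)) * Real.exp (-y / 4)
        * ((1 / 2) ^ m * (y + 1) ^ (-m)) := by ring
    _ = N * (unitBallVolume n * (1 / 2)) * Real.exp (-y / 4)
        * (ρ ^ (-σ) * (Real.sqrt ρ ^ n * ρ)) := by rw [e1, e2]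
    _ = _ := by ring

/-! ### Existence inside the region -/

theorem heatPot_selfSimilar_eq (n : ℕ) {lam α : ℝ} (hlam : 1 < lam)
    {z : SpaceTime n} (hz : 0 < z.2) :
    heatPot n α (fun y => ENNReal.ofReal (selfSimilar n lam α y ^ lam)) z
      = ENNReal.ofReal (z.2 ^ (-(α / (lam - 1))))
        * heatPot n α (fun y => ENNReal.ofReal (selfSimilar n lam α y ^ lam))
          ((Real.sqrt z.2)⁻¹ • z.1, 1) := by
  have hs : Real.sqrt z.2 ≠ 0 := (Real.sqrt_pos.2 hz).ne'
  have hl : lam - 1 ≠ 0 := by linarith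
  have h := heatPot_scaling n α (α * lam / (lam - 1)) hz
    (F := fun y => ENNReal.ofReal (selfSimilar n lam α y ^ lam))
    ((measurable_selfSimilar n lam α).pow_const lam).ennreal_ofReal
    (fun y => by rw [selfSimilar_rpow_scaling n hlam α hz, ENNReal.ofReal_mul (by positivity)])
    ((Real.sqrt z.2)⁻¹ • z.1) 1
  rw [smul_inv_smul₀ hs, mul_one] at h
  have he : α - α * lam / (lam - 1) = -(α / (lam - 1)) := by
    field_simp
    ring
  rw [he] at h
  exact h

/-- The spatial integral of the `p`-th power is of order at most `t ^ (n/2 - σ * p)`, where `σ = α *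
lam / (lam - 1)`; `hσ` makes it integrable at `t = 0`. -/
theorem memXp_selfSimilar_rpow (n : ℕ) {p lam α : ℝ} (hp : 1 ≤ p) (hlam : 1 < lam)
    (hm : 0 ≤ ((n : ℝ) + 2) / 2 - α * lam / (lam - 1))
    (hσ : α * lam / (lam - 1) * p < ((n : ℝ) + 2) / 2) :
    MemXp n p (fun z => selfSimilar n lam α z ^ lam) := by
  intro T
  have hp0 : 0 < p := by linarith
  have hl0 : 0 < lam := by linarith
  refine ⟨((measurable_selfSimilar n lam α).pow_const lam).aestronglyMeasurable, ?_⟩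
  rw [eLpNorm_lt_top_iff_lintegral_rpow_enorm_lt_top (by simpa using hp0) ENNReal.ofReal_ne_top,
    ENNReal.toReal_ofReal hp0.le]
  set σ := α * lam / (lam - 1) with hσd
  have hTm : MeasurableSet ((Set.univ : Set (EuclideanSpace ℝ (Fin n))) ×ˢ Set.Iio T) :=
    MeasurableSet.univ.prod measurableSet_Iio
  have hTm' : MeasurableSet ((Set.univ : Set (EuclideanSpace ℝ (Fin n))) ×ˢ Set.Ioo 0 (max T 0)) :=
    MeasurableSet.univ.prod measurableSet_Ioo
  have hb : 0 < lam * p / 4 := by positivity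
  refine lt_of_le_of_lt ?_ ((lintegral_strip_gaussian n (e := -(σ * p)) (b := lam * p / 4)
    (by linarith) hb (le_max_right T 0)).trans_lt ENNReal.ofReal_lt_top)
  rw [← lintegral_indicator hTm, ← lintegral_indicator hTm']
  refine lintegral_mono fun z => ?_
  by_cases hz : z.2 < T
  · rw [Set.indicator_of_mem (by simpa using hz)]
    rcases lt_or_ge 0 z.2 with h0 | h0
    · rw [Set.indicator_of_mem (by simpa using ⟨h0, Or.inl hz⟩),
        Real.enorm_of_nonneg (Real.rpow_nonneg (selfSimilar_nonneg n lam α z) _),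
        ENNReal.ofReal_rpow_of_nonneg (Real.rpow_nonneg (selfSimilar_nonneg n lam α z) _) hp0.le,
        selfSimilar_rpow_of_pos n hlam α h0]
      refine ENNReal.ofReal_le_ofReal ?_
      have h1 : (‖z.1‖ ^ 2 / z.2 + 1) ^ (-(lam * (((n : ℝ) + 2) / 2 - σ))) ≤ 1 :=
        Real.rpow_le_one_of_one_le_of_nonpos (le_add_of_nonneg_left (by positivity))
          (by nlinarith)
      calc _ ≤ (z.2 ^ (-σ) * Real.exp (-(lam / (4 * z.2) * ‖z.1‖ ^ 2)) * 1) ^ p := by gcongr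
        _ = _ := by
          rw [mul_one, Real.mul_rpow (by positivity) (by positivity), ← Real.rpow_mul h0.le,
            ← Real.exp_mul, neg_mul]
          congr 2
          field_simp
    · rw [selfSimilar_of_nonpos n lam α h0, Real.zero_rpow hl0.ne']
      simp [hp0]
  · rw [Set.indicator_of_notMem (by simpa using hz)]
    exact zero_le

theorem exists_isPointwiseApproxSolution (n : ℕ) {p lam α : ℝ} (hp : 1 ≤ p)
    (hE : (lam, α) ∈ regionE n p) :
    ∃ C₁ C₂ : ℝ, 0 < C₁ ∧ 0 < C₂ ∧
      IsPointwiseApproxSolution n p lam α C₁ C₂ (fun z => selfSimilar n lam α z ^ lam) := by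
  obtain ⟨hlam, hα, hlt⟩ := hE
  simp only at hlam hα hlt
  have hp0 : 0 < p := by linarith
  have hl0 : 0 < lam := by linarith
  have hl : 0 < lam - 1 := by linarith
  -- The inequality defining the region, rearranged as integrability at time zero; as `1 ≤ p`, it
  -- also makes the profile exponent `m` positive.
  have hσ : α * lam / (lam - 1) * p < ((n : ℝ) + 2) / 2 := by
    have h1 : α * (lam * p / (lam - 1))
        < ((n : ℝ) + 2) / (2 * p) * (1 - 1 / lam) * (lam * p / (lam - 1)) := by gcongr
    have h2 : ((n : ℝ) + 2) / (2 * p) * (1 - 1 / lam) * (lam * p / (lam - 1))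
        = ((n : ℝ) + 2) / 2 := by
      field_simp
    rw [h2] at h1
    calc α * lam / (lam - 1) * p = α * (lam * p / (lam - 1)) := by ring
      _ < _ := h1
  have hσ0 : 0 < α * lam / (lam - 1) := by positivity
  have hm : 0 < ((n : ℝ) + 2) / 2 - α * lam / (lam - 1) := by nlinarith
  obtain ⟨A, hA, hlow⟩ := exists_le_heatPot_selfSimilar n hlam hα hm
  obtain ⟨B, hB, hup⟩ := exists_heatPot_selfSimilar_le n hlam hα hm
  have hsol : ∀ z : SpaceTime n,
      ENNReal.ofReal (A * selfSimilar n lam α z)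
        ≤ fracHeatPotential n α (fun z => selfSimilar n lam α z ^ lam) z ∧
      fracHeatPotential n α (fun z => selfSimilar n lam α z ^ lam) z
        ≤ ENNReal.ofReal (B * selfSimilar n lam α z) := by
    intro z
    rw [fracHeatPotential_eq_heatPot n hα]
    rcases lt_or_ge 0 z.2 with hz | hz
    · rw [heatPot_selfSimilar_eq n hlam hz, selfSimilar, if_pos hz]
      constructor
      · rw [mul_left_comm, ENNReal.ofReal_mul (by positivity)]
        exact mul_le_mul_right (hlow _) _
      · rw [mul_left_comm, ENNReal.ofReal_mul (by positivity)]
        exact mul_le_mul_right (hup _) _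
    · have h0 : heatPot n α (fun y => ENNReal.ofReal (selfSimilar n lam α y ^ lam)) z = 0 := by
        refine (lintegral_congr fun y => ?_).trans lintegral_zero
        beta_reduce
        rcases le_or_gt y.2 0 with hy | hy
        · rw [selfSimilar_of_nonpos n lam α hy, Real.zero_rpow hl0.ne', ENNReal.ofReal_zero,
            mul_zero]
        · rw [fracHeatKernel_of_nonpos n α (z - y) (by simp only [Prod.snd_sub]; linarith),
            ENNReal.ofReal_zero, zero_mul]
      rw [h0, selfSimilar_of_nonpos n lam α hz]
      simp
  refine ⟨A ^ lam, B ^ lam, by positivity, by positivity,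
    memXp_selfSimilar_rpow n hp hlam hm.le hσ, fun z => Real.rpow_nonneg
      (selfSimilar_nonneg n lam α z) _, fun z => ?_, fun z => ?_, fun z hz => ?_⟩
  · have := selfSimilar_nonneg n lam α z
    rw [← Real.mul_rpow hA.le this, ← ENNReal.ofReal_rpow_of_nonneg (by positivity) hl0.le]
    exact ENNReal.rpow_le_rpow (hsol z).1 hl0.le
  · have := selfSimilar_nonneg n lam α z
    rw [← Real.mul_rpow hB.le this, ← ENNReal.ofReal_rpow_of_nonneg (by positivity) hl0.le]
    exact ENNReal.rpow_le_rpow (hsol z).2 hl0.le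
  · rw [selfSimilar_of_nonpos n lam α hz.le, Real.zero_rpow hl0.ne']

theorem isNontrivial_selfSimilar_rpow (n : ℕ) (lam α : ℝ) :
    IsNontrivial n (fun z => selfSimilar n lam α z ^ lam) := by
  intro h
  have hnull : volume (Metric.ball 0 1 ×ˢ Set.Ioo 0 1 : Set (SpaceTime n)) = 0 := by
    refine measure_mono_null ?_ (ae_iff.1 h)
    rintro z ⟨-, hz⟩
    exact (Real.rpow_pos_of_pos (selfSimilar_pos n lam α hz.1) lam).ne'
  rw [volume_ball_prod_Ioo n 0 one_pos, ENNReal.ofReal_eq_zero] at hnull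
  have := unitBallVolume_pos n
  norm_num at hnull
  linarith

/-! ### Necessity and conclusion -/

theorem MemXp.aemeasurable {n : ℕ} {p : ℝ} {f : SpaceTime n → ℝ} (h : MemXp n p f) :
    AEMeasurable f := by
  have hU : (⋃ k : ℕ, (Set.univ : Set (EuclideanSpace ℝ (Fin n))) ×ˢ Set.Iio (k : ℝ))
      = Set.univ := by
    refine Set.eq_univ_of_forall fun z => ?_
    obtain ⟨k, hk⟩ := exists_nat_gt z.2
    exact Set.mem_iUnion.2 ⟨k, trivial, hk⟩
  rw [← Measure.restrict_univ (μ := (volume : Measure (SpaceTime n))), ← hU]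
  exact aemeasurable_iUnion_iff.2 fun k => (h k).aestronglyMeasurable.aemeasurable

theorem MemXp.lintegral_rpow_ne_top {n : ℕ} {p : ℝ} (hp : 0 < p) {f : SpaceTime n → ℝ}
    (h : MemXp n p f) (T : ℝ) :
    ∫⁻ z in Set.univ ×ˢ Set.Iio T, ENNReal.ofReal (f z) ^ p ≠ ⊤ := by
  have h1 := (h T).eLpNorm_lt_top
  rw [eLpNorm_lt_top_iff_lintegral_rpow_enorm_lt_top (by simpa using hp) ENNReal.ofReal_ne_top,
    ENNReal.toReal_ofReal hp.le] at h1
  refine ne_top_of_le_ne_top h1.ne (lintegral_mono fun z => ?_)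
  gcongr
  exact Real.ofReal_le_enorm _

theorem volume_strip_eq_top (n : ℕ) (hn : 1 ≤ n) {a b : ℝ} (hab : a < b) :
    volume ((Set.univ : Set (EuclideanSpace ℝ (Fin n))) ×ˢ Set.Ioo a b) = ⊤ := by
  have : NeZero n := ⟨by omega⟩
  rw [Measure.volume_eq_prod, Measure.prod_prod, measure_univ_of_isAddLeftInvariant,
    Real.volume_Ioo]
  exact ENNReal.top_mul (ENNReal.ofReal_pos.2 (by linarith)).ne'

/-- There is no nontrivial solution outside the region `E`. -/
theorem IsApproxSolution.mem_regionE {n : ℕ} (hn : 1 ≤ n) {p lam α C₁ C₂ : ℝ} (hlam : 0 < lam)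
    (hα : 0 < α) (hp : p = 1 ∨ (1 < p ∧ (lam, α) ∉ critCurve n p)) (hC₁ : 0 < C₁) (hC₂ : 0 < C₂)
    {f : SpaceTime n → ℝ} (hf : IsApproxSolution n p lam α C₁ C₂ f) (hne : IsNontrivial n f) :
    (lam, α) ∈ regionE n p := by
  have hp1 : 1 ≤ p := hp.elim (fun h => h.ge) fun h => h.1.le
  have hp0 : 0 < p := by linarith
  have hfm : AEMeasurable (fun z => ENNReal.ofReal (f z)) :=
    hf.memXp.aemeasurable.ennreal_ofReal
  -- The potential ignores null sets, so a Borel representative can replace the source at every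
  -- point of the potential.
  obtain ⟨F, hF, hfF⟩ := hfm
  have hpot : ∀ z, fracHeatPotential n α f z = heatPot n α F z := fun z => by
    rw [fracHeatPotential_eq_heatPot n hα, heatPot_congr_ae n α hfF]
  have hFne : ¬ ∀ᵐ z, F z = 0 := by
    intro h
    apply hne
    filter_upwards [h, hfF, hf.nonneg] with z h1 h2 h3
    rw [h1, ENNReal.ofReal_eq_zero] at h2
    exact le_antisymm h2 h3
  have hFfin : ∀ T : ℝ, ∫⁻ z in Set.univ ×ˢ Set.Iio T, F z ^ p ≠ ⊤ := by
    intro T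
    have := hf.memXp.lintegral_rpow_ne_top hp0 T
    rwa [lintegral_congr_ae (ae_restrict_of_ae (hfF.mono fun z hz => by
      exact congrArg (· ^ p) hz))] at this
  have hF0 : ∀ᵐ z, z.2 < 0 → F z = 0 := by
    filter_upwards [hfF, hf.initial] with z h1 h2 h
    rw [← h1, h2 h, ENNReal.ofReal_zero]
  have hFtop : ∀ᵐ z, F z ≠ ⊤ := by
    filter_upwards [hfF] with z hz
    rw [← hz]
    exact ENNReal.ofReal_ne_top
  have hupper : ∀ᵐ z, F z ≤ ENNReal.ofReal C₁⁻¹ * heatPot n α F z ^ lam := by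
    filter_upwards [hfF, hf.lower] with z h1 h2
    rw [← h1, ← hpot]
    calc ENNReal.ofReal (f z) = ENNReal.ofReal C₁⁻¹ * ENNReal.ofReal (C₁ * f z) := by
          rw [← ENNReal.ofReal_mul (by positivity), inv_mul_cancel_left₀ hC₁.ne']
      _ ≤ _ := by gcongr
  have hlower : ∀ᵐ z, ENNReal.ofReal C₂⁻¹ * heatPot n α F z ^ lam ≤ F z := by
    filter_upwards [hfF, hf.upper] with z h1 h2
    rw [← h1, ← hpot]
    calc _ ≤ ENNReal.ofReal C₂⁻¹ * ENNReal.ofReal (C₂ * f z) := by gcongr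
      _ = ENNReal.ofReal (f z) := by
          rw [← ENNReal.ofReal_mul (by positivity), inv_mul_cancel_left₀ hC₂.ne']
  rcases lt_or_ge lam 1 with hl1 | hl1
  · exfalso
    obtain ⟨m, a, b, hm, hab, hmF⟩ :=
      exists_strip_lower_bound n hα hlam hl1 (inv_pos.2 hC₂) hF hlower hFne
    refine hFfin b (top_le_iff.1 ?_)
    have h1 := const_mul_measure_le_lintegral (μ := volume)
      (S := (Set.univ : Set (EuclideanSpace ℝ (Fin n))) ×ˢ Set.Ioo a b)
      (MeasurableSet.univ.prod measurableSet_Ioo) (c := ENNReal.ofReal m ^ p)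
      (g := fun z => F z ^ p) (by
        filter_upwards [hmF] with z hz hzS
        exact ENNReal.rpow_le_rpow (hz hzS.2) hp0.le)
    rw [volume_strip_eq_top n hn hab, ENNReal.mul_top (by
      simp [ENNReal.rpow_eq_zero_iff, hm, hp0.not_gt])] at h1
    exact h1.trans (lintegral_mono_set (Set.prod_mono_right Set.Ioo_subset_Iio_self))
  · have hle : α ≤ ((n : ℝ) + 2) / (2 * p) * (1 - 1 / lam) := by
      by_contra! h
      exact hFne (ae_eq_zero_of_le_heatPot_rpow n hα hp1 hl1 h hF ENNReal.ofReal_ne_top hupper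
        hFfin hF0)
    -- At `lam = 1` the right side of `hle` is zero, which contradicts `0 < α`.
    have hl : 1 < lam := by
      refine lt_of_le_of_ne hl1 fun h => ?_
      rw [← h] at hle
      norm_num at hle
      linarith
    refine ⟨hl, hα, lt_of_le_of_ne hle fun h => ?_⟩
    rcases hp with rfl | ⟨-, hcurve⟩
    · rw [mul_one] at h
      exact hFne (ae_eq_zero_of_heatPot_rpow_le_of_critical n hα hl (inv_pos.2 hC₂) h hF hlower
        hFtop)
    · exact hcurve ⟨hl, h⟩

theorem theorem3p2 (n : ℕ) (hn : 1 ≤ n) (p lam α : ℝ) (hlam : 0 < lam) (hα : 0 < α)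
    (hp : p = 1 ∨ (1 < p ∧ (lam, α) ∉ critCurve n p)) :
    ((∃ C₁ C₂ : ℝ, 0 < C₁ ∧ 0 < C₂ ∧ ∃ f : SpaceTime n → ℝ,
        IsApproxSolution n p lam α C₁ C₂ f ∧ IsNontrivial n f) ↔
      (lam, α) ∈ regionE n p) ∧
    ((lam, α) ∈ regionE n p →
      ∃ C₁ C₂ : ℝ, 0 < C₁ ∧ 0 < C₂ ∧
        IsPointwiseApproxSolution n p lam α C₁ C₂ (fun z => selfSimilar n lam α z ^ lam) ∧
        IsNontrivial n (fun z => selfSimilar n lam α z ^ lam)) := by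
  have hp1 : 1 ≤ p := hp.elim (fun h => h.ge) fun h => h.1.le
  have hex : (lam, α) ∈ regionE n p → ∃ C₁ C₂ : ℝ, 0 < C₁ ∧ 0 < C₂ ∧
      IsPointwiseApproxSolution n p lam α C₁ C₂ (fun z => selfSimilar n lam α z ^ lam) ∧
      IsNontrivial n (fun z => selfSimilar n lam α z ^ lam) := by
    intro hE
    obtain ⟨C₁, C₂, h1, h2, hsol⟩ := exists_isPointwiseApproxSolution n hp1 hE
    exact ⟨C₁, C₂, h1, h2, hsol, isNontrivial_selfSimilar_rpow n lam α⟩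
  refine ⟨⟨?_, fun hE => ?_⟩, hex⟩
  · rintro ⟨C₁, C₂, h1, h2, f, hf, hne⟩
    exact hf.mem_regionE hn hlam hα hp h1 h2 hne
  · obtain ⟨C₁, C₂, h1, h2, hsol, hne⟩ := hex hE
    exact ⟨C₁, C₂, h1, h2, _, hsol.isApproxSolution, hne⟩
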